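/- **Theorem 1.3.** Let $m\ge 2$, $d\ge 1$, and let $\Sigma=\{1,\dots,m\}^{\mathbb N}$ carry the metric $d(x,y)=m^{-n}$, where $n\geq 1$ is the first index with $x_n\neq y_n$ (and $d(x,x)=0$). Let $A$ be a primitive $m\times m$ matrix with entries in $\{0,1\}$, let $\Sigma_A=\{x\in\Sigma : A_{x_k,x_{k+1}}=1 \text{ for all } k\ge1\}$ be the associated subshift of finite type with the shift map $\sigma$, let $\Sigma_{A,n}$ be the set of words $J=j_1\cdots j_n$ with $A_{j_k,j_{k+1}}=1$ for $1\le k<n$, and put $[J]=\{x\in\Sigma_A : x_k=j_k,\ 1\le k\le n\}$. For a $d\times d$ matrix $B$ with nonnegative entries let $\|B\|$ be the sum of its entries. Let $M$ be a Hölder continuous function on $\Sigma_A$ whose values are $d\times d$ matrices with strictly positive entries. Then for every $q\in\mathbb R$ the limit $$P(q)=\lim_{n\to\infty}\frac1n\log\sum_{J\in\Sigma_{A,n}}\ \sup_{x\in[J]}\|M(x)M(\sigma x)\cdots M(\sigma^{n-1}x)\|^q$$ exists in $\mathbb R$, and for every $q\neq0$ the function $P$ is differentiable at $q$ and, with $\alpha=P'(q)$,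 the level set $$E(\alpha)=\Big\{x\in\Sigma_A:\ \lim_{n\to\infty}\frac1n\log\|M(x)M(\sigma x)\cdots M(\sigma^{n-1}x)\|=\alpha\Big\}$$ has Hausdorff dimension $$\dim_H E(\alpha)=\frac{-\alpha q+P(q)}{\log m}.$$ -/

import Mathlib

namespace MatrixPressure

/-- The symbolic space of all one-sided sequences over an alphabet of `m` letters. Coordinates are
numbered from `0`, so that `x.letter k` is the letter which is usually written `x_{k+1}`. -/
@[ext]
structure FullShift (m : ℕ) : Type where
  letter : ℕ → Fin m

namespace FullShift

variable {m : ℕ}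

/-- `d(x, y) = m ^ (-n)`, where `n ≥ 1` is the position (counted from `1`) of the first letter in
which `x` and `y` differ; `d(x, x) = 0`. -/
noncomputable instance : Dist (FullShift m) where
  dist x y := open Classical in
    if x = y then 0 else ((m : ℝ)⁻¹) ^ (PiNat.firstDiff x.letter y.letter + 1)

theorem dist_self' (x : FullShift m) : dist x x = 0 := if_pos rfl

theorem dist_of_ne {x y : FullShift m} (h : x ≠ y) :
    dist x y = ((m : ℝ)⁻¹) ^ (PiNat.firstDiff x.letter y.letter + 1) := if_neg h

theorem card_pos (x : FullShift m) : 0 < m := (Nat.zero_le _).trans_lt (x.letter 0).isLt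

theorem dist_nonneg' (x y : FullShift m) : 0 ≤ dist x y := by
  by_cases h : x = y
  · rw [h, dist_self']
  · rw [dist_of_ne h]; positivity

theorem dist_triangle' (x y z : FullShift m) : dist x z ≤ dist x y + dist y z := by
  by_cases hxz : x = z
  · rw [hxz, dist_self']
    exact add_nonneg (dist_nonneg' _ _) (dist_nonneg' _ _)
  by_cases hxy : x = y
  · rw [hxy, dist_self', zero_add]
  by_cases hyz : y = z
  · rw [hyz, dist_self', add_zero]
  have hm : (1 : ℝ) ≤ m := by exact_mod_cast card_pos x
  have h0 : (0 : ℝ) ≤ (m : ℝ)⁻¹ := by positivity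
  have h1 : (m : ℝ)⁻¹ ≤ 1 := inv_le_one_of_one_le₀ hm
  rcases min_le_iff.1 (PiNat.min_firstDiff_le x.letter y.letter z.letter (mt FullShift.ext hxz)) with h | h
  · refine le_trans ?_ (le_add_of_nonneg_right (dist_nonneg' y z))
    rw [dist_of_ne hxz, dist_of_ne hxy]
    exact pow_le_pow_of_le_one h0 h1 (Nat.succ_le_succ h)
  · refine le_trans ?_ (le_add_of_nonneg_left (dist_nonneg' x y))
    rw [dist_of_ne hxz, dist_of_ne hyz]
    exact pow_le_pow_of_le_one h0 h1 (Nat.succ_le_succ h)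

noncomputable instance : MetricSpace (FullShift m) where
  dist_self := dist_self'
  dist_comm x y := by
    by_cases h : x = y
    · rw [h]
    · rw [dist_of_ne h, dist_of_ne (Ne.symm h), PiNat.firstDiff_comm]
  dist_triangle := dist_triangle'
  eq_of_dist_eq_zero {x y} h := by
    by_contra hne
    rw [dist_of_ne hne] at h
    have hm : (0 : ℝ) < m := by exact_mod_cast card_pos x
    exact absurd h (by positivity)

end FullShift

variable {m d : ℕ}

/-- The subshift of finite type `Σ_A`, with the metric induced from the symbolic space. -/
def Subshift (A : Matrix (Fin m) (Fin m) ℤ) : Set (FullShift m) :=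
  {x | ∀ k : ℕ, A (x.letter k) (x.letter (k + 1)) = 1}

/-- The shift map `σ` on `Σ_A`. -/
def shift {A : Matrix (Fin m) (Fin m) ℤ} (x : Subshift A) : Subshift A :=
  ⟨⟨fun k => x.1.letter (k + 1)⟩, fun k => x.2 (k + 1)⟩

/-- `J` is an admissible word of length `n`. -/
def Admissible (A : Matrix (Fin m) (Fin m) ℤ) {n : ℕ} (J : Fin n → Fin m) : Prop :=
  ∀ (k : ℕ) (hk : k + 1 < n), A (J ⟨k, Nat.lt_of_succ_lt hk⟩) (J ⟨k + 1, hk⟩) = 1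

/-- The cylinder set `[J]` in `Σ_A`. -/
def cylinder (A : Matrix (Fin m) (Fin m) ℤ) {n : ℕ} (J : Fin n → Fin m) : Set (Subshift A) :=
  {x | ∀ k : Fin n, x.1.letter k = J k}

/-- The norm `‖B‖ = 1ᵗ B 1` of a nonnegative matrix, that is, the sum of its entries. -/
def entrySum (B : Matrix (Fin d) (Fin d) ℝ) : ℝ := ∑ i, ∑ j, B i j

/-- The matrix product `M(x) M(σ x) ⋯ M(σ^{n-1} x)`, in this order. -/
def cocycle {A : Matrix (Fin m) (Fin m) ℤ} (M : Subshift A → Matrix (Fin d) (Fin d) ℝ)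
    (n : ℕ) (x : Subshift A) : Matrix (Fin d) (Fin d) ℝ :=
  ((List.range n).map fun k => M (shift^[k] x)).prod

open Classical in
/-- `∑_J sup_{x ∈ [J]} ‖M(x) M(σ x) ⋯ M(σ^{n-1} x)‖ ^ q`, the sum being over the admissible words
`J` of length `n`. -/
noncomputable def partitionSum {A : Matrix (Fin m) (Fin m) ℤ}
    (M : Subshift A → Matrix (Fin d) (Fin d) ℝ) (q : ℝ) (n : ℕ) : ℝ :=
  ∑ J : Fin n → Fin m with Admissible A J, ⨆ x : cylinder A J, entrySum (cocycle M n x.1) ^ q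

/-- The pressure function `P(q)` of `M`, the limit of `(1 / n) log` of the partition sums. -/
noncomputable def pressure {A : Matrix (Fin m) (Fin m) ℤ}
    (M : Subshift A → Matrix (Fin d) (Fin d) ℝ) (q : ℝ) : ℝ :=
  Filter.limUnder Filter.atTop fun n : ℕ => Real.log (partitionSum M q n) / n

/-- The level set `E(α)`. -/
def levelSet {A : Matrix (Fin m) (Fin m) ℤ} (M : Subshift A → Matrix (Fin d) (Fin d) ℝ)
    (α : ℝ) : Set (Subshift A) :=
  {x | Filter.Tendsto (fun n : ℕ => Real.log (entrySum (cocycle M n x)) / n)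
    Filter.atTop (nhds α)}

/-- Hölder continuity of a matrix-valued function; all norms on the space of matrices being
equivalent, this is Hölder continuity of all the entries. -/
def IsHolder {X : Type*} [PseudoEMetricSpace X] (M : X → Matrix (Fin d) (Fin d) ℝ) : Prop :=
  ∃ C r : NNReal, 0 < r ∧ ∀ i j, HolderWith C r fun x => M x i j

end MatrixPressure

/-! Positivity turns the matrix product into an almost additive potential. By compactness the
entries of `M` lie between two positive constants, so the columns of a product are comparable and
the log-norm is additive along the shift up to a constant (`exists_entrySum_almost_mul`); Hölder
continuity gives bounded distortion on cylinders (`exists_distortion`). The rest concerns an almost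
additive `ψ` on a subshift whose words can be glued across a gap of fixed length `p`.

Cutting and gluing words make the partition functions multiplicative up to constants, so they equal
`exp (n * P q)` up to bounded factors. Weighted point masses, averaged along orbits, then have an
invariant Gibbs limit `ν` (`exists_isGibbs`).

Differentiability needs neither ergodicity nor uniqueness of `ν`. Under `ν`, two blocks of length
`n` separated by a gap have a joint law dominating a multiple of the product law. Hence doubling the
length multiplies the variance by less than `4`, up to an additive constant, and the variance of `ψ
n` is `o(n ^ 2)` along a sequence (`frequently_varianceAt_le`). The Laplace transform of `ψ n` at `±
s / n` then shows that a corner of the convex function `P` at `q`, multiplied by any `s > 0`, stays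
bounded, so there is none (`exists_hasDerivAt`).

With `α = P'(q)`, exponential tail bounds and Borel–Cantelli put `ν` on the level set. Counting
cylinders bounds its dimension from above (`dimH_le`), and the mass distribution principle for `ν`
bounds it from below (`le_dimH`). -/

open Filter Topology MeasureTheory

namespace MatrixPressure

variable {m d : ℕ} {A : Matrix (Fin m) (Fin m) ℤ}

/-! ### Prefixes, cylinders and the topology of the subshift -/

/-- `x` and `y` have the same first `n` letters. -/
def Agree (n : ℕ) (x y : Subshift A) : Prop := ∀ k < n, x.1.letter k = y.1.letter k

theorem Agree.refl (n : ℕ) (x : Subshift A) : Agree n x x := fun _ _ => rfl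

theorem Agree.symm {n : ℕ} {x y : Subshift A} (h : Agree n x y) : Agree n y x :=
  fun k hk => (h k hk).symm

theorem Agree.trans {n : ℕ} {x y z : Subshift A} (h : Agree n x y) (h' : Agree n y z) :
    Agree n x z := fun k hk => (h k hk).trans (h' k hk)

theorem Agree.mono {n k : ℕ} (hkn : k ≤ n) {x y : Subshift A} (h : Agree n x y) : Agree k x y :=
  fun l hl => h l (hl.trans_le hkn)

theorem shift_iterate_letter (n k : ℕ) (x : Subshift A) :
    (shift^[n] x).1.letter k = x.1.letter (n + k) := by
  induction n generalizing x with
  | zero => simp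
  | succ n ih =>
    rw [Function.iterate_succ_apply, ih]
    change x.1.letter (n + k + 1) = _
    congr 1; omega

theorem agree_add_iff {n k : ℕ} {x y : Subshift A} :
    Agree (n + k) x y ↔ Agree n x y ∧ Agree k (shift^[n] x) (shift^[n] y) := by
  constructor
  · intro h
    refine ⟨h.mono (Nat.le_add_right _ _), fun l hl => ?_⟩
    rw [shift_iterate_letter, shift_iterate_letter]
    exact h _ (by omega)
  · rintro ⟨h1, h2⟩ l hl
    by_cases hn : l < n
    · exact h1 l hn
    · have := h2 (l - n) (by omega)
      rw [shift_iterate_letter, shift_iterate_letter] at this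
      rwa [show n + (l - n) = l by omega] at this

/-- Agreement on the letters `0, …, n - 1` means that the first difference has index at least `n`,
and index `i` corresponds to distance `m ^ (-(i + 1))`. -/
theorem FullShift.dist_le_iff (hm : 2 ≤ m) {n : ℕ} {x y : FullShift m} :
    dist x y ≤ ((m : ℝ)⁻¹) ^ (n + 1) ↔ ∀ k < n, x.letter k = y.letter k := by
  have hm' : (1 : ℝ) < m := by exact_mod_cast hm
  have h0 : 0 < (m : ℝ)⁻¹ := by positivity
  have h1 : (m : ℝ)⁻¹ < 1 := inv_lt_one_of_one_lt₀ hm'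
  by_cases h : x = y
  · subst h
    simp only [dist_self, implies_true, iff_true]
    positivity
  · rw [FullShift.dist_of_ne h, pow_le_pow_iff_right_of_lt_one₀ h0 h1]
    have hne : x.letter ≠ y.letter := mt FullShift.ext h
    constructor
    · intro hn k hk
      exact PiNat.apply_eq_of_lt_firstDiff (by omega)
    · intro hk
      by_contra hlt
      exact PiNat.apply_firstDiff_ne hne (hk _ (by omega))

theorem dist_le_iff_agree (hm : 2 ≤ m) {n : ℕ} {x y : Subshift A} :
    dist x y ≤ ((m : ℝ)⁻¹) ^ (n + 1) ↔ Agree n x y :=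
  FullShift.dist_le_iff hm

theorem FullShift.continuous_letter (hm : 2 ≤ m) (k : ℕ) :
    Continuous fun x : FullShift m => x.letter k := by
  refine (IsLocallyConstant.iff_eventually_eq _).2 (fun x => ?_) |>.continuous
  have hpos : 0 < ((m : ℝ)⁻¹) ^ (k + 1 + 1) := by positivity
  filter_upwards [Metric.ball_mem_nhds x hpos] with y hy
  exact (FullShift.dist_le_iff hm).1 (Metric.mem_ball.1 hy).le k (Nat.lt_succ_self k)

theorem tendsto_inv_pow (hm : 2 ≤ m) :
    Tendsto (fun n : ℕ => ((m : ℝ)⁻¹) ^ (n + 1)) atTop (𝓝 0) := by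
  have hm' : (1 : ℝ) < m := by exact_mod_cast hm
  exact (tendsto_pow_atTop_nhds_zero_of_lt_one (by positivity)
    (inv_lt_one_of_one_lt₀ hm')).comp (tendsto_add_atTop_nat 1)

/-- The space is a continuous image of a product of finite discrete spaces. -/
theorem FullShift.compactSpace (hm : 2 ≤ m) : CompactSpace (FullShift m) := by
  have hc : Continuous (FullShift.mk : (ℕ → Fin m) → FullShift m) := by
    rw [continuous_iff_continuousAt]
    intro x
    rw [ContinuousAt, Metric.tendsto_nhds]
    intro ε hε
    obtain ⟨n, hn⟩ := ((tendsto_inv_pow hm).eventually (gt_mem_nhds hε)).exists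
    have : ∀ᶠ y in 𝓝 x, ∀ k ∈ Finset.range n, y k = x k := by
      rw [Filter.eventually_all_finset]
      intro k _
      have := (continuous_apply k).continuousAt.tendsto (x := x)
      exact this.eventually (p := fun z => z = x k) (by simp [nhds_discrete])
    filter_upwards [this] with y hy
    refine lt_of_le_of_lt ((FullShift.dist_le_iff hm).2 fun k hk => ?_) hn
    exact hy k (Finset.mem_range.2 hk)
  have hs : Function.Surjective (FullShift.mk : (ℕ → Fin m) → FullShift m) := fun x => ⟨x.letter, rfl⟩
  exact hs.compactSpace hc

theorem Subshift.compactSpace (hm : 2 ≤ m) : CompactSpace (Subshift A) := by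
  have := FullShift.compactSpace hm
  refine isCompact_iff_compactSpace.1 (IsClosed.isCompact ?_)
  have : Subshift A = ⋂ k : ℕ, {x | A (x.letter k) (x.letter (k + 1)) = 1} := by
    ext x; simp [Subshift]
  rw [this]
  refine isClosed_iInter fun k => ?_
  have hc : Continuous fun x : FullShift m => A (x.letter k) (x.letter (k + 1)) :=
    (continuous_of_discreteTopology (f := fun p : Fin m × Fin m => A p.1 p.2)).comp
      ((FullShift.continuous_letter hm k).prodMk (FullShift.continuous_letter hm (k + 1)))
  exact isClosed_eq hc continuous_const

noncomputable instance : MeasurableSpace (FullShift m) := borel _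
instance : BorelSpace (FullShift m) := ⟨rfl⟩

theorem continuous_of_agree (hm : 2 ≤ m) {Y : Type*} [TopologicalSpace Y] {n : ℕ}
    {f : Subshift A → Y} (hf : ∀ x y, Agree n x y → f x = f y) : Continuous f := by
  refine (IsLocallyConstant.iff_eventually_eq _).2 (fun x => ?_) |>.continuous
  have hpos : 0 < ((m : ℝ)⁻¹) ^ (n + 1) := by positivity
  filter_upwards [Metric.ball_mem_nhds x hpos] with y hy
  exact hf _ _ ((dist_le_iff_agree hm).1 (Metric.mem_ball.1 hy).le)

theorem continuous_shift (hm : 2 ≤ m) : Continuous (shift : Subshift A → Subshift A) := by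
  rw [Metric.continuous_iff]
  intro x ε hε
  obtain ⟨n, hn⟩ := ((tendsto_inv_pow hm).eventually (gt_mem_nhds hε)).exists
  refine ⟨((m : ℝ)⁻¹) ^ (n + 1 + 1), by positivity, fun y hy => lt_of_le_of_lt ?_ hn⟩
  rw [dist_le_iff_agree hm]
  have := (dist_le_iff_agree hm).1 hy.le
  rw [add_comm, agree_add_iff] at this
  exact this.2

/-- The set of points with the same first `n` letters as `x`. -/
def cyl (n : ℕ) (x : Subshift A) : Set (Subshift A) := {y | Agree n x y}

/-- The word formed by the first `n` letters of `x`. -/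
def word (n : ℕ) (x : Subshift A) : Fin n → Fin m := fun k => x.1.letter k

theorem word_eq_iff {n : ℕ} {x y : Subshift A} : word n x = word n y ↔ Agree n x y := by
  simp only [funext_iff, word, Agree]
  exact ⟨fun h k hk => h ⟨k, hk⟩, fun h k => h k k.2⟩

theorem isClopen_cyl (hm : 2 ≤ m) (n : ℕ) (x : Subshift A) : IsClopen (cyl n x) := by
  have hc : Continuous (word n : Subshift A → Fin n → Fin m) :=
    continuous_of_agree hm fun _ _ h => word_eq_iff.2 h
  have := (isClopen_discrete {word n x}).preimage hc
  convert this using 1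
  ext y
  rw [Set.mem_preimage, Set.mem_singleton_iff, word_eq_iff]
  exact ⟨Agree.symm, Agree.symm⟩

theorem measurableSet_cyl (hm : 2 ≤ m) (n : ℕ) (x : Subshift A) : MeasurableSet (cyl n x) :=
  (isClopen_cyl hm n x).2.measurableSet

/-! ### Representatives of the cylinders -/

/-- A point which has the same first `n` letters as `x` and depends only on these. -/
noncomputable def rep (n : ℕ) (x : Subshift A) : Subshift A :=
  Classical.choose (⟨x, rfl⟩ : ∃ y : Subshift A, word n y = word n x)

theorem agree_rep (n : ℕ) (x : Subshift A) : Agree n (rep n x) x :=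
  word_eq_iff.1 (Classical.choose_spec (⟨x, rfl⟩ : ∃ y : Subshift A, word n y = word n x))

theorem rep_eq_rep {n : ℕ} {x y : Subshift A} (h : Agree n x y) : rep n x = rep n y := by
  have := word_eq_iff.2 h
  -- `x` enters the choice only through `word n x`.
  simp only [rep, this]

theorem agree_of_rep_eq {n : ℕ} {x y : Subshift A} (h : rep n x = rep n y) : Agree n x y :=
  (agree_rep n x).symm.trans (h ▸ agree_rep n y)

theorem finite_range_rep (n : ℕ) : (Set.range (rep n : Subshift A → Subshift A)).Finite := by
  refine Set.Finite.of_finite_image (f := word n) (Set.toFinite _) ?_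
  rintro _ ⟨x, rfl⟩ _ ⟨y, rfl⟩ h
  have h' := word_eq_iff.1 h
  exact rep_eq_rep (((agree_rep n x).symm.trans h').trans (agree_rep n y))

/-- Representatives of the nonempty cylinders of length `n`. -/
noncomputable def reps (A : Matrix (Fin m) (Fin m) ℤ) (n : ℕ) : Finset (Subshift A) :=
  (finite_range_rep (A := A) n).toFinset

theorem rep_mem_reps (n : ℕ) (x : Subshift A) : rep n x ∈ reps A n := by simp [reps]

theorem rep_of_mem {n : ℕ} {x : Subshift A} (hx : x ∈ reps A n) : rep n x = x := by
  simp only [reps, Set.Finite.mem_toFinset, Set.mem_range] at hx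
  obtain ⟨y, rfl⟩ := hx
  exact rep_eq_rep (agree_rep n y)

theorem reps_eq_of_agree {n : ℕ} {x y : Subshift A} (hx : x ∈ reps A n) (hy : y ∈ reps A n)
    (h : Agree n x y) : x = y := by
  rw [← rep_of_mem hx, ← rep_of_mem hy]
  exact rep_eq_rep h

/-! ### Gluing -/

theorem exists_path (hA01 : ∀ i j, A i j = 0 ∨ A i j = 1) (k : ℕ) (i j : Fin m)
    (h : (A ^ k) i j ≠ 0) : ∃ w : ℕ → Fin m, w 0 = i ∧ w k = j ∧ ∀ l < k, A (w l) (w (l + 1)) = 1 := by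
  induction k generalizing j with
  | zero =>
    refine ⟨fun _ => i, rfl, ?_, by simp⟩
    by_contra hij
    exact h (by simp [Matrix.one_apply_ne hij])
  | succ k ih =>
    rw [pow_succ, Matrix.mul_apply] at h
    obtain ⟨l, -, hl⟩ := Finset.exists_ne_zero_of_sum_ne_zero h
    obtain ⟨w, h0, h1, h2⟩ := ih l (left_ne_zero_of_mul hl)
    refine ⟨fun t => if t ≤ k then w t else j, by simpa using h0, by simp, fun t ht => ?_⟩
    rcases Nat.lt_succ_iff_lt_or_eq.1 ht with ht' | rfl
    · simpa [ht'.le, Nat.succ_le_iff.2 ht'] using h2 t ht'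
    · simpa [h1] using (hA01 l j).resolve_left (right_ne_zero_of_mul hl)

theorem exists_glue (hA01 : ∀ i j, A i j = 0 ∨ A i j = 1) (hA : A.IsPrimitive) :
    ∃ p : ℕ, ∀ (n : ℕ) (x y : Subshift A), ∃ z : Subshift A,
      Agree n x z ∧ shift^[n + p] z = y := by
  obtain ⟨k, hk, hpos⟩ := hA.exists_pos_pow
  obtain ⟨p, rfl⟩ : ∃ p, k = p + 1 := ⟨k - 1, by omega⟩
  refine ⟨p, fun n x y => ?_⟩
  -- A path of `p + 1` edges has `p` interior letters, which form the bridge. For `n = 0` the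
  -- truncated `n - 1` is harmless, since no letter of `x` is kept.
  obtain ⟨w, h0, h1, h2⟩ := exists_path hA01 (p + 1) (x.1.letter (n - 1)) (y.1.letter 0)
    (hpos _ _).ne'
  refine ⟨⟨⟨fun l => if l < n then x.1.letter l else if l < n + p then w (l - n + 1)
    else y.1.letter (l - (n + p))⟩, fun l => ?_⟩, fun l hl => by simp [hl], ?_⟩
  · dsimp only
    by_cases c1 : l + 1 < n
    · rw [if_pos (by omega), if_pos c1]; exact x.2 l
    by_cases c2 : l < n
    · obtain rfl : l = n - 1 := by omega
      rw [if_pos c2, if_neg c1, ← h0, show n - 1 + 1 = n by omega]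
      by_cases c3 : n < n + p
      · rw [if_pos c3, Nat.sub_self]; exact h2 0 (by omega)
      · obtain rfl : p = 0 := by omega
        rw [if_neg c3]; simp only [add_zero, Nat.sub_self]; rw [← h1]; exact h2 0 (by omega)
    rw [if_neg c2, if_neg c1]
    by_cases c3 : l + 1 < n + p
    · rw [if_pos (by omega), if_pos c3, show l + 1 - n + 1 = l - n + 1 + 1 by omega]
      exact h2 _ (by omega)
    by_cases c4 : l < n + p
    · rw [if_pos c4, if_neg c3, show l + 1 - (n + p) = 0 by omega, ← h1,
        show p + 1 = l - n + 1 + 1 by omega]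
      exact h2 _ (by omega)
    · rw [if_neg c4, if_neg c3, show l + 1 - (n + p) = l - (n + p) + 1 by omega]
      exact y.2 _
  · apply Subtype.ext
    ext l : 2
    rw [shift_iterate_letter]
    dsimp only
    rw [if_neg (by omega), if_neg (by omega)]
    congr 1; omega

theorem Subshift.nonempty (hm : 2 ≤ m) (hA01 : ∀ i j, A i j = 0 ∨ A i j = 1)
    (hA : A.IsPrimitive) : Nonempty (Subshift A) := by
  obtain ⟨k, hk, hpos⟩ := hA.exists_pos_pow
  have hs : ∀ i, ∃ j, A i j = 1 := fun i => by
    obtain ⟨w, h0, -, h2⟩ := exists_path hA01 k i i (hpos i i).ne'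
    exact ⟨w 1, by simpa [h0] using h2 0 hk⟩
  choose s hs using hs
  exact ⟨⟨⟨fun n => s^[n] ⟨0, by omega⟩⟩, fun n => by
    simp only [Function.iterate_succ_apply']; exact hs _⟩⟩

/-! ### Almost additive potentials and their pressure -/

/-- The common form of all comparisons of partition sums: words are cut or glued injectively, and
the weights are compared term by term. -/
theorem sum_le_sum_of_injOn {ι κ : Type*} {s : Finset ι} {t : Finset κ} {F : ι → κ}
    {f : ι → ℝ} {g : κ → ℝ} (hF : ∀ i ∈ s, F i ∈ t) (hinj : Set.InjOn F s)
    (hfg : ∀ i ∈ s, f i ≤ g (F i)) (hg : ∀ k ∈ t, 0 ≤ g k) : ∑ i ∈ s, f i ≤ ∑ k ∈ t, g k := by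
  classical
  calc ∑ i ∈ s, f i ≤ ∑ i ∈ s, g (F i) := Finset.sum_le_sum hfg
    _ = ∑ k ∈ s.image F, g k := (Finset.sum_image hinj).symm
    _ ≤ ∑ k ∈ t, g k := Finset.sum_le_sum_of_subset_of_nonneg
        (Finset.image_subset_iff.2 hF) fun k hk _ => hg k hk

/-- Both `z + c` and `-z + c` are subadditive. Fekete's lemma gives them opposite limits, and the
limits being infima yields the two-sided bound. -/
theorem exists_tendsto_of_almost_additive {z : ℕ → ℝ} {c : ℝ}
    (h : ∀ n k, |z (n + k) - z n - z k| ≤ c) :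
    ∃ P : ℝ, Tendsto (fun n : ℕ => z n / n) atTop (𝓝 P) ∧ ∀ n : ℕ, |z n - n * P| ≤ c := by
  have hc : 0 ≤ c := (abs_nonneg _).trans (h 0 0)
  have hz0 : |z 0| ≤ c := by simpa using h 0 0
  have hlin : ∀ n : ℕ, |z n| ≤ c + n * (|z 1| + c) := by
    intro n
    induction n with
    | zero => simpa using hz0
    | succ n ih =>
      have h1 := abs_le.1 (h n 1)
      have h2 := abs_le.1 ih
      have h3 := abs_le.1 (le_refl |z 1|)
      push_cast
      rw [abs_le]
      constructor <;> nlinarith [h1.1, h1.2, h2.1, h2.2, h3.1, h3.2]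
  have hbd : ∀ u : ℕ → ℝ, (∀ n, -(2 * c + n * (|z 1| + c)) ≤ u n) →
      BddBelow (Set.range fun n : ℕ => u n / n) := by
    rintro u hu
    refine ⟨-(3 * c + |z 1|), ?_⟩
    rintro _ ⟨n, rfl⟩
    rcases Nat.eq_zero_or_pos n with rfl | hn
    · simp only [Nat.cast_zero, div_zero]; linarith [abs_nonneg (z 1)]
    · have hn' : (1 : ℝ) ≤ n := by exact_mod_cast hn
      simp only
      rw [le_div_iff₀ (by linarith)]
      nlinarith [hu n]
  have hsub1 : Subadditive fun n => z n + c := fun n k => by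
    have := (abs_le.1 (h n k)).2; simp only; linarith
  have hsub2 : Subadditive fun n => -z n + c := fun n k => by
    have := (abs_le.1 (h n k)).1; simp only; linarith
  have hb1 := hbd (fun n => z n + c) fun n => by have := (abs_le.1 (hlin n)).1; linarith
  have hb2 := hbd (fun n => -z n + c) fun n => by have := (abs_le.1 (hlin n)).2; linarith
  have ht1 := hsub1.tendsto_lim hb1
  have ht2 := hsub2.tendsto_lim hb2
  have hcn : Tendsto (fun n : ℕ => c / (n : ℝ)) atTop (𝓝 0) :=
    tendsto_const_nhds.div_atTop tendsto_natCast_atTop_atTop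
  have ht : Tendsto (fun n : ℕ => z n / n) atTop (𝓝 hsub1.lim) := by
    have := ht1.sub hcn
    simpa [add_div] using this
  have heq : hsub2.lim = -hsub1.lim := by
    have := ht.neg.add hcn
    refine tendsto_nhds_unique ht2 ?_
    rw [add_zero] at this
    refine this.congr fun n => ?_
    rw [add_div, neg_div]
  refine ⟨hsub1.lim, ht, fun n => ?_⟩
  rcases Nat.eq_zero_or_pos n with rfl | hn
  · simpa using hz0
  · have hn' : (0 : ℝ) < n := by exact_mod_cast hn
    have e1 := hsub1.lim_le_div hb1 hn.ne'
    have e2 := hsub2.lim_le_div hb2 hn.ne'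
    rw [heq] at e2
    rw [le_div_iff₀ hn'] at e1 e2
    rw [abs_le]
    constructor <;> nlinarith

/-- A sequence of functions, the `n`-th of which depends on the first `n` letters only, which is
additive along the shift up to the constant `C`. -/
structure AlmostAdditive (ψ : ℕ → Subshift A → ℝ) (C : ℝ) : Prop where
  eq_of_agree : ∀ n x y, Agree n x y → ψ n x = ψ n y
  abs_add_le : ∀ n k x, |ψ (n + k) x - ψ n x - ψ k (shift^[n] x)| ≤ C

/-- Any two points can be joined by a word of length `p`. -/
def HasGluing (A : Matrix (Fin m) (Fin m) ℤ) (p : ℕ) : Prop :=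
  ∀ (n : ℕ) (x y : Subshift A), ∃ z : Subshift A, Agree n x z ∧ shift^[n + p] z = y

/-- The partition function of the potential `ψ` at the parameter `q`. -/
noncomputable def partitionFn (ψ : ℕ → Subshift A → ℝ) (q : ℝ) (n : ℕ) : ℝ :=
  ∑ x ∈ reps A n, Real.exp (q * ψ n x)

theorem partitionFn_pos [Nonempty (Subshift A)] (ψ : ℕ → Subshift A → ℝ) (q : ℝ) (n : ℕ) :
    0 < partitionFn ψ q n :=
  Finset.sum_pos (fun _ _ => Real.exp_pos _)
    ⟨rep n (Classical.arbitrary (Subshift A)), rep_mem_reps _ _⟩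

namespace AlmostAdditive

variable {ψ : ℕ → Subshift A → ℝ} {C : ℝ} {p : ℕ}

theorem rep_eq (h : AlmostAdditive ψ C) (n : ℕ) (x : Subshift A) : ψ n (rep n x) = ψ n x :=
  h.eq_of_agree n _ _ (agree_rep n x)

theorem exists_bound (h : AlmostAdditive ψ C) (n : ℕ) : ∃ B : ℝ, 0 ≤ B ∧ ∀ x, |ψ n x| ≤ B := by
  refine ⟨∑ x ∈ reps A n, |ψ n x|, Finset.sum_nonneg fun _ _ => abs_nonneg _, fun x => ?_⟩
  rw [← h.rep_eq]
  exact Finset.single_le_sum (f := fun x => |ψ n x|) (fun _ _ => abs_nonneg _) (rep_mem_reps n x)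

theorem exists_linear_bound (h : AlmostAdditive ψ C) (hC : 0 ≤ C) :
    ∃ L : ℝ, 0 ≤ L ∧ ∀ (n : ℕ) x, |ψ n x| ≤ L * (n + 1) := by
  obtain ⟨B₀, hB₀, h₀⟩ := h.exists_bound 0
  obtain ⟨B₁, hB₁, h₁⟩ := h.exists_bound 1
  refine ⟨B₀ + B₁ + C, by linarith, fun n x => ?_⟩
  induction n with
  | zero => simpa using (h₀ x).trans (by linarith)
  | succ n ih =>
    have e1 := abs_le.1 (h.abs_add_le n 1 x)
    have e2 := abs_le.1 ih
    have e3 := abs_le.1 (h₁ (shift^[n] x))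
    push_cast
    rw [abs_le]
    constructor <;> nlinarith [e1.1, e1.2, e2.1, e2.2, e3.1, e3.2]

/-- Almost additivity is used twice; the bridge contributes a bounded amount because `ψ p` takes
finitely many values. -/
theorem exists_glue_bound (h : AlmostAdditive ψ C) (p : ℕ) : ∃ D : ℝ, 0 ≤ D ∧
    ∀ (n k : ℕ) (x y z : Subshift A), Agree n x z → shift^[n + p] z = y →
      |ψ (n + p + k) z - ψ n x - ψ k y| ≤ D := by
  obtain ⟨B, hB, hb⟩ := h.exists_bound p
  refine ⟨2 * |C| + B, by positivity, fun n k x y z hx hy => ?_⟩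
  have e1 := abs_le.1 ((h.abs_add_le (n + p) k z).trans (le_abs_self C))
  have e2 := abs_le.1 ((h.abs_add_le n p z).trans (le_abs_self C))
  have e3 := abs_le.1 (hb (shift^[n] z))
  rw [hy] at e1
  rw [h.eq_of_agree n x z hx, abs_le]
  constructor <;> linarith [e1.1, e1.2, e2.1, e2.2, e3.1, e3.2]

theorem mul_le_of_abs {q Q a b : ℝ} (hq : |q| ≤ Q) (hb : |a| ≤ b) : |q * a| ≤ Q * b := by
  rw [abs_mul]
  exact mul_le_mul hq hb (abs_nonneg _) ((abs_nonneg _).trans hq)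

theorem partitionFn_add_le (h : AlmostAdditive ψ C) {q Q : ℝ} (hq : |q| ≤ Q) (n k : ℕ) :
    partitionFn ψ q (n + k) ≤ Real.exp (Q * C) * (partitionFn ψ q n * partitionFn ψ q k) := by
  unfold partitionFn
  rw [Finset.sum_mul_sum, ← Finset.sum_product', Finset.mul_sum]
  refine sum_le_sum_of_injOn (F := fun x => (rep n x, rep k (shift^[n] x)))
    (fun x _ => Finset.mk_mem_product (rep_mem_reps _ _) (rep_mem_reps _ _)) ?_ ?_ ?_
  · intro x hx y hy hxy
    simp only [Prod.mk.injEq] at hxy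
    exact reps_eq_of_agree hx hy
      (agree_add_iff.2 ⟨agree_of_rep_eq hxy.1, agree_of_rep_eq hxy.2⟩)
  · intro x _
    simp only [h.rep_eq]
    rw [← Real.exp_add, ← Real.exp_add, Real.exp_le_exp]
    have := (abs_le.1 (mul_le_of_abs hq (h.abs_add_le n k x))).2
    nlinarith
  · intro _ _; positivity

/-- Gluing is injective on pairs of representatives: the prefix and the shifted tail of the glued
word recover the pair. -/
theorem partitionFn_mul_le (h : AlmostAdditive ψ C) (hp : HasGluing A p) : ∃ D : ℝ, 0 ≤ D ∧
    ∀ (q Q : ℝ), |q| ≤ Q → ∀ n k : ℕ, partitionFn ψ q n * partitionFn ψ q k ≤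
      Real.exp (Q * D) * partitionFn ψ q (n + p + k) := by
  obtain ⟨D, hD, hd⟩ := h.exists_glue_bound p
  choose g hg using hp
  refine ⟨D, hD, fun q Q hq n k => ?_⟩
  unfold partitionFn
  rw [Finset.sum_mul_sum, ← Finset.sum_product', Finset.mul_sum]
  refine sum_le_sum_of_injOn (F := fun x => rep (n + p + k) (g n x.1 x.2))
    (fun x _ => rep_mem_reps _ _) ?_ ?_ ?_
  · rintro ⟨x, y⟩ hxy ⟨x', y'⟩ hxy' heq
    simp only [Finset.coe_product, Set.mem_prod, Finset.mem_coe] at hxy hxy'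
    obtain ⟨h1, h2⟩ := agree_add_iff.1 (agree_of_rep_eq heq)
    simp only at h1 h2
    rw [(hg _ _ _).2, (hg _ _ _).2] at h2
    have h1' := h1.mono (Nat.le_add_right n p)
    exact Prod.ext (reps_eq_of_agree hxy.1 hxy'.1 (((hg _ _ _).1.trans h1').trans (hg _ _ _).1.symm))
      (reps_eq_of_agree hxy.2 hxy'.2 h2)
  · rintro ⟨x, y⟩ _
    simp only [h.rep_eq]
    rw [← Real.exp_add, ← Real.exp_add, Real.exp_le_exp]
    have := (abs_le.1 (mul_le_of_abs hq (hd n k x y _ (hg n x y).1 (hg n x y).2))).1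
    nlinarith
  · intro _ _; positivity

/-- The lower bound passes through length `n + k + p`: gluing reaches it, and cutting off the last
`p` letters costs a factor bounded for `|q| ≤ Q`. Uniformity in `q` is needed later, when the
parameter is perturbed. -/
theorem exists_partitionFn_bound (h : AlmostAdditive ψ C) [Nonempty (Subshift A)]
    (hp : HasGluing A p) (Q : ℝ) : ∃ c : ℝ, ∀ q, |q| ≤ Q → ∀ n k : ℕ,
      |Real.log (partitionFn ψ q (n + k)) - Real.log (partitionFn ψ q n) -
        Real.log (partitionFn ψ q k)| ≤ c := by
  obtain ⟨D, hD, hd⟩ := h.partitionFn_mul_le hp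
  obtain ⟨B, hB, hb⟩ := h.exists_bound p
  have hC : 0 ≤ C := (abs_nonneg _).trans (h.abs_add_le 0 0 (Classical.arbitrary _))
  have hpos := partitionFn_pos ψ
  refine ⟨Q * C + Q * D + |Real.log ((reps A p).card * Real.exp (Q * B))|, fun q hq n k => ?_⟩
  have hQ : 0 ≤ Q := (abs_nonneg _).trans hq
  have hlog1 : ∀ n k, Real.log (partitionFn ψ q (n + k)) ≤
      Q * C + (Real.log (partitionFn ψ q n) + Real.log (partitionFn ψ q k)) := by
    intro n k
    rw [← Real.log_mul (hpos _ _).ne' (hpos _ _).ne', ← Real.log_exp (Q * C),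
      ← Real.log_mul (Real.exp_pos _).ne' (mul_pos (hpos _ _) (hpos _ _)).ne']
    exact Real.log_le_log (hpos _ _) (h.partitionFn_add_le hq n k)
  have hlog2 : Real.log (partitionFn ψ q n) + Real.log (partitionFn ψ q k) ≤
      Q * D + Real.log (partitionFn ψ q (n + k + p)) := by
    rw [← Real.log_mul (hpos _ _).ne' (hpos _ _).ne', ← Real.log_exp (Q * D),
      ← Real.log_mul (Real.exp_pos _).ne' (hpos _ _).ne',
      show n + k + p = n + p + k by ring]
    exact Real.log_le_log (mul_pos (hpos _ _) (hpos _ _)) (hd q Q hq n k)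
  have hlog3 : Real.log (partitionFn ψ q p) ≤ Real.log ((reps A p).card * Real.exp (Q * B)) := by
    refine Real.log_le_log (hpos _ _) ?_
    rw [← nsmul_eq_mul]
    refine Finset.sum_le_card_nsmul _ _ _ fun x _ => ?_
    exact Real.exp_le_exp.2 ((le_abs_self _).trans (mul_le_of_abs hq (hb x)))
  have h1 := hlog1 n k
  have h2 := hlog1 (n + k) p
  have h3 := le_abs_self (Real.log ((reps A p).card * Real.exp (Q * B)))
  have h4 : 0 ≤ Q * C := mul_nonneg hQ hC
  have h5 : 0 ≤ Q * D := mul_nonneg hQ hD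
  rw [abs_le]
  constructor <;> linarith [abs_nonneg (Real.log ((reps A p).card * Real.exp (Q * B)))]

end AlmostAdditive

/-- `P` is the pressure function of the potential `ψ`: it is comparable to the partition functions,
locally uniformly in the parameter. -/
structure IsPressure (ψ : ℕ → Subshift A → ℝ) (P : ℝ → ℝ) : Prop where
  tendsto : ∀ q, Tendsto (fun n : ℕ => Real.log (partitionFn ψ q n) / n) atTop (𝓝 (P q))
  exists_bound : ∀ Q : ℝ, ∃ c : ℝ, 0 ≤ c ∧ ∀ q, |q| ≤ Q → ∀ n : ℕ,
    partitionFn ψ q n ≤ Real.exp (n * P q + c) ∧ Real.exp (n * P q - c) ≤ partitionFn ψ q n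

theorem AlmostAdditive.exists_isPressure [Nonempty (Subshift A)] {ψ : ℕ → Subshift A → ℝ} {C : ℝ}
    (h : AlmostAdditive ψ C) {p : ℕ} (hp : HasGluing A p) : ∃ P : ℝ → ℝ, IsPressure ψ P := by
  have hex : ∀ q, ∃ P : ℝ, Tendsto (fun n : ℕ => Real.log (partitionFn ψ q n) / n) atTop (𝓝 P) := by
    intro q
    obtain ⟨c, hc⟩ := h.exists_partitionFn_bound hp |q|
    exact (exists_tendsto_of_almost_additive (hc q le_rfl)).imp fun _ h => h.1
  choose P hP using hex
  refine ⟨P, hP, fun Q => ?_⟩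
  obtain ⟨c, hc⟩ := h.exists_partitionFn_bound hp Q
  refine ⟨|c|, abs_nonneg c, fun q hq n => ?_⟩
  obtain ⟨P', ht, hb⟩ := exists_tendsto_of_almost_additive
    (z := fun n => Real.log (partitionFn ψ q n)) (hc q hq)
  -- The limit was chosen for each `q` separately; uniqueness of limits transfers the uniform
  -- constant to it.
  obtain rfl := tendsto_nhds_unique ht (hP q)
  have := abs_le.1 ((hb n).trans (le_abs_self c))
  have hpos := partitionFn_pos ψ q n
  rw [← Real.log_le_iff_le_exp hpos, ← Real.le_log_iff_exp_le hpos]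
  constructor <;> linarith [this.1, this.2]

/-- Hölder's inequality with the conjugate exponents `1 / a` and `1 / b`. -/
theorem convexOn_log_partitionFn [Nonempty (Subshift A)] (ψ : ℕ → Subshift A → ℝ) (n : ℕ) :
    ConvexOn ℝ Set.univ fun q => Real.log (partitionFn ψ q n) := by
  refine ⟨convex_univ, fun x _ y _ a b ha hb hab => ?_⟩
  rcases ha.eq_or_lt with rfl | ha
  · obtain rfl : b = 1 := by linarith
    simp
  rcases hb.eq_or_lt with rfl | hb
  · obtain rfl : a = 1 := by linarith
    simp
  have hx := partitionFn_pos ψ x n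
  have hy := partitionFn_pos ψ y n
  simp only [smul_eq_mul]
  rw [← Real.log_rpow hx, ← Real.log_rpow hy, ← Real.log_mul (by positivity) (by positivity)]
  refine Real.log_le_log (partitionFn_pos _ _ _) ?_
  have hpq : (a⁻¹).HolderConjugate (b⁻¹) := by
    rw [Real.holderConjugate_iff]
    refine ⟨(one_lt_inv₀ ha).2 (by linarith), by simpa using hab⟩
  have := Real.inner_le_Lp_mul_Lq_of_nonneg (reps A n) hpq
    (f := fun t => Real.exp (a * (x * ψ n t))) (g := fun t => Real.exp (b * (y * ψ n t)))
    (fun _ _ => (Real.exp_pos _).le) (fun _ _ => (Real.exp_pos _).le)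
  simp only [← Real.exp_add, ← Real.exp_mul, one_div, inv_inv] at this
  unfold partitionFn
  convert this using 3 <;> (try congr 1) <;> (try (ext t; congr 1; field_simp))
  ring_nf

theorem IsPressure.convexOn [Nonempty (Subshift A)] {ψ : ℕ → Subshift A → ℝ} {P : ℝ → ℝ}
    (h : IsPressure ψ P) : ConvexOn ℝ Set.univ P := by
  refine ⟨convex_univ, fun x _ y _ a b ha hb hab => ?_⟩
  refine le_of_tendsto_of_tendsto' (h.tendsto _)
    (((h.tendsto x).const_mul a).add ((h.tendsto y).const_mul b)) fun n => ?_
  have := (convexOn_log_partitionFn ψ n).2 (Set.mem_univ x) (Set.mem_univ y) ha hb hab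
  simp only [smul_eq_mul] at this ⊢
  calc _ ≤ _ := div_le_div_of_nonneg_right this (Nat.cast_nonneg n)
    _ = _ := by ring

/-! ### Invariant Gibbs measures -/

open Classical in
/-- The part of the partition function of length `N` which comes from the points whose image under
`shift^[M]` lies in the cylinder of length `n` around `z`. -/
noncomputable def cylSum (ψ : ℕ → Subshift A → ℝ) (q : ℝ) (N M n : ℕ) (z : Subshift A) : ℝ :=
  ∑ x ∈ reps A N with shift^[M] x ∈ cyl n z, Real.exp (q * ψ N x)

namespace AlmostAdditive

variable {ψ : ℕ → Subshift A → ℝ} {C : ℝ} {p : ℕ}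

/-- The middle block is prescribed by `z`, so only the outer blocks of lengths `M` and `K` are free;
the two cuts cost `2 * C`. -/
theorem cylSum_le (h : AlmostAdditive ψ C) (q : ℝ) (M n K : ℕ) (z : Subshift A) :
    cylSum ψ q (M + n + K) M n z ≤ Real.exp (|q| * (2 * C)) * Real.exp (q * ψ n z) *
      (partitionFn ψ q M * partitionFn ψ q K) := by
  classical
  unfold partitionFn cylSum
  rw [Finset.sum_mul_sum, ← Finset.sum_product', Finset.mul_sum]
  refine sum_le_sum_of_injOn (F := fun x => (rep M x, rep K (shift^[M + n] x)))
    (fun x _ => Finset.mk_mem_product (rep_mem_reps _ _) (rep_mem_reps _ _)) ?_ ?_ ?_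
  · intro x hx y hy hxy
    simp only [Prod.mk.injEq] at hxy
    simp only [Finset.coe_filter, Set.mem_ofPred_eq] at hx hy
    exact reps_eq_of_agree hx.1 hy.1 (agree_add_iff.2
      ⟨agree_add_iff.2 ⟨agree_of_rep_eq hxy.1, hx.2.symm.trans hy.2⟩, agree_of_rep_eq hxy.2⟩)
  · intro x hx
    simp only [h.rep_eq]
    rw [← Real.exp_add, ← Real.exp_add, ← Real.exp_add, Real.exp_le_exp]
    have e1 := h.abs_add_le (M + n) K x
    have e2 := h.abs_add_le M n x
    rw [← h.eq_of_agree n _ _ (Finset.mem_filter.1 hx).2] at e2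
    have e3 : |ψ (M + n + K) x - ψ M x - ψ n z - ψ K (shift^[M + n] x)| ≤ 2 * C := by
      rw [abs_le] at e1 e2 ⊢
      constructor <;> linarith [e1.1, e1.2, e2.1, e2.2]
    have := (abs_le.1 (mul_le_of_abs le_rfl e3 (q := q))).2
    nlinarith
  · intro _ _; positivity

/-- Two bridges of length `p` join arbitrary outer words to the prefix of `z`, each at cost `D`. -/
theorem le_cylSum (h : AlmostAdditive ψ C) (hp : HasGluing A p) : ∃ D : ℝ, 0 ≤ D ∧
    ∀ (q : ℝ) (M n K : ℕ) (z : Subshift A),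
      Real.exp (q * ψ n z) * (partitionFn ψ q M * partitionFn ψ q K) ≤
        Real.exp (|q| * D) * cylSum ψ q (M + p + (n + p + K)) (M + p) n z := by
  obtain ⟨D, hD, hd⟩ := h.exists_glue_bound p
  choose g hg using hp
  refine ⟨2 * D, by positivity, fun q M n K z => ?_⟩
  classical
  unfold partitionFn cylSum
  rw [Finset.sum_mul_sum, ← Finset.sum_product', Finset.mul_sum, Finset.mul_sum]
  have hsh : ∀ x y, Agree (n + p + K) (shift^[M + p] (rep (M + p + (n + p + K))
      (g M x (g n z y)))) (g n z y) := fun x y => by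
    have := (agree_add_iff.1 (agree_rep (M + p + (n + p + K)) (g M x (g n z y)))).2
    rwa [(hg _ _ _).2] at this
  refine sum_le_sum_of_injOn (F := fun x => rep (M + p + (n + p + K)) (g M x.1 (g n z x.2)))
    ?_ ?_ ?_ ?_
  · rintro ⟨x, y⟩ _
    refine Finset.mem_filter.2 ⟨rep_mem_reps _ _, ?_⟩
    exact (hg n z y).1.trans ((hsh x y).mono (by omega)).symm
  · rintro ⟨x, y⟩ hxy ⟨x', y'⟩ hxy' heq
    simp only [Finset.coe_product, Set.mem_prod, Finset.mem_coe] at hxy hxy'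
    obtain ⟨h1, h2⟩ := agree_add_iff.1 (agree_of_rep_eq heq)
    simp only at h1 h2
    rw [(hg _ _ _).2, (hg _ _ _).2] at h2
    have h3 := (agree_add_iff.1 h2).2
    rw [(hg _ _ _).2, (hg _ _ _).2] at h3
    have h1' := h1.mono (Nat.le_add_right M p)
    exact Prod.ext (reps_eq_of_agree hxy.1 hxy'.1
      (((hg _ _ _).1.trans h1').trans (hg _ _ _).1.symm)) (reps_eq_of_agree hxy.2 hxy'.2 h3)
  · rintro ⟨x, y⟩ _
    simp only [h.rep_eq]
    rw [← Real.exp_add, ← Real.exp_add, ← Real.exp_add, Real.exp_le_exp]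
    have e1 := hd M (n + p + K) x _ _ (hg M x (g n z y)).1 (hg M x (g n z y)).2
    have e2 := hd n K z y _ (hg n z y).1 (hg n z y).2
    have e3 : |ψ (M + p + (n + p + K)) (g M x (g n z y)) - ψ M x - ψ n z - ψ K y| ≤ 2 * D := by
      rw [abs_le] at e1 e2 ⊢
      constructor <;> linarith [e1.1, e1.2, e2.1, e2.2]
    have := (abs_le.1 (mul_le_of_abs le_rfl e3 (q := q))).1
    nlinarith
  · intro _ _; positivity

/-- The Gibbs property before the limit, with a constant independent of `N` and `M`. -/
theorem exists_cylSum_bound (h : AlmostAdditive ψ C) (hp : HasGluing A p) {P : ℝ → ℝ}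
    (hP : IsPressure ψ P) (q : ℝ) : ∃ G : ℝ, ∀ (N M n : ℕ) (z : Subshift A), M + n ≤ N →
      cylSum ψ q N M n z ≤ Real.exp (q * ψ n z - n * P q + G) * partitionFn ψ q N ∧
      (p ≤ M → M + n + p ≤ N →
        Real.exp (q * ψ n z - n * P q - G) * partitionFn ψ q N ≤ cylSum ψ q N M n z) := by
  obtain ⟨D, hD, hd⟩ := h.le_cylSum hp
  obtain ⟨c, hc0, hc⟩ := hP.exists_bound |q|
  replace hc := hc q le_rfl
  -- Each direction uses the pressure bounds at three lengths, whence `3 * c`; the term `2 * p * P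
  -- q` accounts for the letters of the two bridges.
  have hG1 := le_max_left (|q| * (2 * C) + 3 * c) (|q| * D + 3 * c + 2 * p * P q)
  have hG2 := le_max_right (|q| * (2 * C) + 3 * c) (|q| * D + 3 * c + 2 * p * P q)
  set G := max (|q| * (2 * C) + 3 * c) (|q| * D + 3 * c + 2 * p * P q)
  have hpos : ∀ n, 0 ≤ partitionFn ψ q n := fun n => Finset.sum_nonneg fun _ _ => (Real.exp_pos _).le
  refine ⟨G, fun N M n z hN => ⟨?_, fun hM hN' => ?_⟩⟩
  · obtain ⟨K, rfl⟩ := Nat.exists_eq_add_of_le hN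
    calc _ ≤ _ := h.cylSum_le q M n K z
      _ ≤ Real.exp (|q| * (2 * C)) * Real.exp (q * ψ n z) *
          (Real.exp (M * P q + c) * Real.exp (K * P q + c)) := by
        have := hpos K
        have := hpos M
        gcongr
        exacts [(hc M).1, (hc K).1]
      _ ≤ Real.exp (q * ψ n z - n * P q + G) * Real.exp ((M + n + K : ℕ) * P q - c) := by
        simp only [← Real.exp_add]
        rw [Real.exp_le_exp]
        push_cast
        linarith
      _ ≤ _ := by gcongr; exact (hc _).2
  · obtain ⟨M, rfl⟩ := Nat.exists_eq_add_of_le' hM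
    obtain ⟨K, rfl⟩ := Nat.exists_eq_add_of_le hN'
    have := hd q M n K z
    rw [show M + p + (n + p + K) = M + p + n + p + K by ring] at this
    have e : Real.exp (q * ψ n z - n * P q - G) * partitionFn ψ q (M + p + n + p + K) *
        Real.exp (|q| * D) ≤
        Real.exp (|q| * D) * cylSum ψ q (M + p + n + p + K) (M + p) n z := by
      refine le_trans ?_ this
      calc _ ≤ Real.exp (q * ψ n z - n * P q - G) *
            Real.exp ((M + p + n + p + K : ℕ) * P q + c) * Real.exp (|q| * D) := by
            gcongr; exact (hc _).1
        _ ≤ Real.exp (q * ψ n z) * (Real.exp (M * P q - c) * Real.exp (K * P q - c)) := by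
          simp only [← Real.exp_add]
          rw [Real.exp_le_exp]
          push_cast
          linarith
        _ ≤ _ := by
          gcongr
          exacts [hpos M, (hc M).2, (hc K).2]
    rw [mul_comm] at e
    exact le_of_mul_le_mul_left e (Real.exp_pos _)

end AlmostAdditive

/-- `ν` is an invariant Gibbs probability measure for `q • ψ`, where `P` is the pressure function
of `ψ`. -/
structure IsGibbs (ψ : ℕ → Subshift A → ℝ) (P : ℝ → ℝ) (q G : ℝ) (ν : Measure (Subshift A)) :
    Prop where
  prob : IsProbabilityMeasure ν
  measurePreserving : MeasurePreserving shift ν ν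
  le_cyl : ∀ n x, Real.exp (q * ψ n x - n * P q - G) ≤ ν.real (cyl n x)
  cyl_le : ∀ n x, ν.real (cyl n x) ≤ Real.exp (q * ψ n x - n * P q + G)

/-- The averaged weighted point masses which approximate the Gibbs measure. -/
noncomputable def mixture (ψ : ℕ → Subshift A → ℝ) (q : ℝ) (N : ℕ) : Measure (Subshift A) :=
  -- The times `N + i` fill the middle third of `[0, 3 * N)`, so a bridge fits on either side of a
  -- fixed cylinder once `N` is large; averaging over `i` gives asymptotic invariance.
  ∑ i ∈ Finset.range N, ∑ x ∈ reps A (3 * N),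
    ENNReal.ofReal (Real.exp (q * ψ (3 * N) x) / (N * partitionFn ψ q (3 * N))) •
      Measure.dirac (shift^[N + i] x)

/-! ### Estimates for the approximating measures -/

section

variable [Nonempty (Subshift A)] (ψ : ℕ → Subshift A → ℝ) (q : ℝ)

theorem integral_mixture (N : ℕ) (f : Subshift A → ℝ) :
    ∫ x, f x ∂(mixture ψ q N) = (∑ i ∈ Finset.range N, (∑ x ∈ reps A (3 * N),
      Real.exp (q * ψ (3 * N) x) * f (shift^[N + i] x)) / partitionFn ψ q (3 * N)) / N := by
  have hInt : ∀ (c : ENNReal) (_ : c ≠ ⊤) y, Integrable f (c • Measure.dirac y) := fun c hc y =>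
    (integrable_dirac (by finiteness)).smul_measure hc
  unfold mixture
  rw [integral_finsetSum_measure fun i _ => integrable_finsetSum_measure.2 fun x _ => hInt _ (by finiteness) _,
    Finset.sum_div]
  refine Finset.sum_congr rfl fun i _ => ?_
  rw [integral_finsetSum_measure fun x _ => hInt _ (by finiteness) _, Finset.sum_div, Finset.sum_div]
  refine Finset.sum_congr rfl fun x _ => ?_
  have := partitionFn_pos ψ q (3 * N)
  rw [integral_smul_measure, integral_dirac, ENNReal.toReal_ofReal (by positivity), smul_eq_mul]
  rw [mul_div_right_comm, mul_div_right_comm, div_div, mul_comm (N : ℝ)]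

theorem isProbabilityMeasure_mixture {N : ℕ} (hN : N ≠ 0) :
    IsProbabilityMeasure (mixture ψ q N) := by
  have h := integral_mixture ψ q N (fun _ => 1)
  have hN' : (N : ℝ) ≠ 0 := by exact_mod_cast hN
  have hZ := (partitionFn_pos ψ q (3 * N)).ne'
  have h1 : ∀ i ∈ Finset.range N, (∑ x ∈ reps A (3 * N),
      Real.exp (q * ψ (3 * N) x) * (1 : ℝ)) / partitionFn ψ q (3 * N) = 1 := fun i _ => by
    simp only [mul_one]; exact div_self hZ
  rw [Finset.sum_congr rfl h1, integral_const] at h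
  simp only [smul_eq_mul, mul_one, Finset.sum_const, Finset.card_range, nsmul_eq_mul,
    div_self hN'] at h
  constructor
  rw [measureReal_def] at h
  rw [← ENNReal.toReal_eq_one_iff]
  exact h

theorem mixture_real_cyl (hm : 2 ≤ m) (N n : ℕ) (z : Subshift A) :
    (mixture ψ q N).real (cyl n z) = (∑ i ∈ Finset.range N,
      cylSum ψ q (3 * N) (N + i) n z / partitionFn ψ q (3 * N)) / N := by
  classical
  rw [← integral_indicator_one (measurableSet_cyl hm n z), integral_mixture]
  congr 1
  refine Finset.sum_congr rfl fun i _ => ?_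
  congr 1
  rw [cylSum, Finset.sum_filter]
  refine Finset.sum_congr rfl fun x _ => ?_
  by_cases hx : shift^[N + i] x ∈ cyl n z <;> simp [hx]

/-- The sum over `i` telescopes to two boundary terms, each at most `B` in absolute value. -/
theorem mixture_invariance (N : ℕ) (f : Subshift A → ℝ) {B : ℝ} (hf : ∀ x, |f x| ≤ B) :
    |∫ x, f (shift x) ∂(mixture ψ q N) - ∫ x, f x ∂(mixture ψ q N)| ≤ 2 * B / N := by
  rw [integral_mixture, integral_mixture, ← sub_div, ← Finset.sum_sub_distrib]
  set a : ℕ → ℝ := fun i => (∑ x ∈ reps A (3 * N),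
      Real.exp (q * ψ (3 * N) x) * f (shift^[N + i] x)) / partitionFn ψ q (3 * N) with ha
  have hZ := partitionFn_pos ψ q (3 * N)
  have hb : ∀ i, |a i| ≤ B := by
    intro i
    rw [ha]
    simp only
    rw [abs_div, abs_of_pos hZ, div_le_iff₀ hZ, partitionFn, Finset.mul_sum]
    refine (Finset.abs_sum_le_sum_abs _ _).trans (Finset.sum_le_sum fun x _ => ?_)
    rw [abs_mul, abs_of_pos (Real.exp_pos _), mul_comm]
    gcongr
    exact hf _
  have : ∀ i ∈ Finset.range N, (∑ x ∈ reps A (3 * N), Real.exp (q * ψ (3 * N) x) *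
      f (shift (shift^[N + i] x))) / partitionFn ψ q (3 * N) - (∑ x ∈ reps A (3 * N),
      Real.exp (q * ψ (3 * N) x) * f (shift^[N + i] x)) / partitionFn ψ q (3 * N) =
      a (i + 1) - a i := fun i _ => by
    simp only [ha, ← add_assoc, Function.iterate_succ_apply']
  rw [Finset.sum_congr rfl this, Finset.sum_range_sub, abs_div, Nat.abs_cast]
  gcongr
  have := abs_sub (a N) (a 0)
  linarith [hb N, hb 0]

end

/-- Probability measures on a compact metric space form a compact space, so the averages converge
along an ultrafilter. Cylinders are clopen, hence their masses converge too and the uniform bounds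
survive. -/
theorem AlmostAdditive.exists_isGibbs (hm : 2 ≤ m) [Nonempty (Subshift A)]
    {ψ : ℕ → Subshift A → ℝ} {C : ℝ} (h : AlmostAdditive ψ C) {p : ℕ} (hp : HasGluing A p)
    {P : ℝ → ℝ} (hP : IsPressure ψ P) (q : ℝ) : ∃ G ν, IsGibbs ψ P q G ν := by
  obtain ⟨G, hG⟩ := h.exists_cylSum_bound hp hP q
  have := Subshift.compactSpace (A := A) hm
  let μ : ℕ → ProbabilityMeasure (Subshift A) := fun N =>
    ⟨mixture ψ q (N + 1), isProbabilityMeasure_mixture ψ q (Nat.succ_ne_zero N)⟩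
  let U : Ultrafilter ℕ := hyperfilter ℕ
  have hU : (U : Filter ℕ) ≤ atTop := Nat.hyperfilter_le_atTop
  obtain ⟨ν, -, hν⟩ := isCompact_univ.ultrafilter_le_nhds (U.map μ) (by simp)
  replace hν : Tendsto μ U (𝓝 ν) := hν
  have hcyl : ∀ n x, Tendsto (fun N => (mixture ψ q (N + 1)).real (cyl n x)) U
      (𝓝 ((ν : Measure (Subshift A)).real (cyl n x))) := fun n x =>
    (NNReal.continuous_coe.tendsto _).comp
      (ProbabilityMeasure.tendsto_measure_of_isClopen_of_tendsto hν (isClopen_cyl hm n x))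
  have hshift := continuous_shift (A := A) hm
  refine ⟨G, ν, inferInstance, ⟨hshift.measurable, ?_⟩, fun n x => ?_, fun n x => ?_⟩
  · have : IsProbabilityMeasure (Measure.map shift (ν : Measure (Subshift A))) :=
      Measure.isProbabilityMeasure_map hshift.measurable.aemeasurable
    refine ext_of_forall_integral_eq_of_IsFiniteMeasure fun f => ?_
    rw [integral_map hshift.measurable.aemeasurable f.continuous.aestronglyMeasurable]
    have h1 := (ProbabilityMeasure.tendsto_iff_forall_integral_tendsto.1 hν) f
    have h2 := (ProbabilityMeasure.tendsto_iff_forall_integral_tendsto.1 hν)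
      (f.compContinuous ⟨shift, hshift⟩)
    have h3 : Tendsto (fun N : ℕ => 2 * ‖f‖ / ((N + 1 : ℕ) : ℝ)) U (𝓝 0) :=
      (tendsto_const_nhds.div_atTop (tendsto_natCast_atTop_atTop.comp
        (tendsto_add_atTop_nat 1))).mono_left hU
    have h4 : Tendsto (fun N => ∫ x, f (shift x) ∂(mixture ψ q (N + 1)) -
        ∫ x, f x ∂(mixture ψ q (N + 1))) U (𝓝 0) :=
      squeeze_zero_norm (fun N => mixture_invariance ψ q (N + 1) f fun x => f.norm_coe_le_norm x) h3
    exact sub_eq_zero.1 (tendsto_nhds_unique (h2.sub h1) h4)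
  · refine ge_of_tendsto (hcyl n x) (hU ?_)
    filter_upwards [eventually_ge_atTop (n + p)] with N hN
    rw [mixture_real_cyl ψ q hm, le_div_iff₀ (by positivity)]
    have : ∀ i ∈ Finset.range (N + 1), Real.exp (q * ψ n x - n * P q - G) ≤
        cylSum ψ q (3 * (N + 1)) (N + 1 + i) n x / partitionFn ψ q (3 * (N + 1)) := fun i hi => by
      rw [Finset.mem_range] at hi
      rw [le_div_iff₀ (partitionFn_pos _ _ _)]
      exact (hG _ _ _ _ (by omega)).2 (by omega) (by omega)
    have := Finset.card_nsmul_le_sum _ _ _ this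
    rw [Finset.card_range, nsmul_eq_mul] at this
    linarith
  · refine le_of_tendsto (hcyl n x) (hU ?_)
    filter_upwards [eventually_ge_atTop (n + p)] with N hN
    rw [mixture_real_cyl ψ q hm, div_le_iff₀ (by positivity)]
    have : ∀ i ∈ Finset.range (N + 1),
        cylSum ψ q (3 * (N + 1)) (N + 1 + i) n x / partitionFn ψ q (3 * (N + 1)) ≤
        Real.exp (q * ψ n x - n * P q + G) := fun i hi => by
      rw [Finset.mem_range] at hi
      rw [div_le_iff₀ (partitionFn_pos _ _ _)]
      exact (hG _ _ _ _ (by omega)).1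
    have := Finset.sum_le_card_nsmul _ _ _ this
    rw [Finset.card_range, nsmul_eq_mul] at this
    linarith

/-! ### Variance of the potential under a Gibbs measure -/

theorem eq_sum_indicator {n : ℕ} {f : Subshift A → ℝ} (hf : ∀ x y, Agree n x y → f x = f y) :
    f = fun y => ∑ x ∈ reps A n, (cyl n x).indicator (fun _ => f x) y := by
  ext y
  rw [Finset.sum_eq_single (rep n y)]
  · rw [Set.indicator_of_mem (show y ∈ cyl n (rep n y) from agree_rep n y),
      hf _ _ (agree_rep n y)]
  · intro x hx hne
    refine Set.indicator_of_notMem (fun hy => hne ?_) _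
    exact reps_eq_of_agree hx (rep_mem_reps n y) (Agree.trans hy (agree_rep n y).symm)
  · exact fun h => absurd (rep_mem_reps n y) h

theorem integrable_of_agree (hm : 2 ≤ m) (ν : Measure (Subshift A)) [IsFiniteMeasure ν]
    {n : ℕ} {f : Subshift A → ℝ} (hf : ∀ x y, Agree n x y → f x = f y) :
    Integrable f ν := by
  rw [eq_sum_indicator hf]
  exact integrable_finsetSum _ fun x _ =>
    (integrable_const _).indicator (measurableSet_cyl hm n x)

theorem integral_eq_sum (hm : 2 ≤ m) (ν : Measure (Subshift A)) [IsFiniteMeasure ν]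
    {n : ℕ} {f : Subshift A → ℝ} (hf : ∀ x y, Agree n x y → f x = f y) :
    ∫ x, f x ∂ν = ∑ x ∈ reps A n, ν.real (cyl n x) * f x := by
  conv_lhs => rw [eq_sum_indicator hf]
  rw [integral_finsetSum _ fun x _ =>
    (integrable_const _).indicator (measurableSet_cyl hm n x)]
  refine Finset.sum_congr rfl fun x _ => ?_
  rw [integral_indicator_const _ (measurableSet_cyl hm n x), smul_eq_mul]

/-- For independent copies of a centred variable, the mean square of the difference is twice the
variance. -/
theorem sum_sum_mul_sub_sq {ι : Type*} (s : Finset ι) (w Y : ι → ℝ) (hw : ∑ i ∈ s, w i = 1)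
    (hY : ∑ i ∈ s, w i * Y i = 0) :
    ∑ x ∈ s ×ˢ s, w x.1 * w x.2 * (Y x.1 - Y x.2) ^ 2 = 2 * ∑ i ∈ s, w i * Y i ^ 2 := by
  have e : ∀ x : ι × ι, w x.1 * w x.2 * (Y x.1 - Y x.2) ^ 2 =
      (w x.1 * Y x.1 ^ 2) * w x.2 + w x.1 * (w x.2 * Y x.2 ^ 2) -
        2 * ((w x.1 * Y x.1) * (w x.2 * Y x.2)) := fun x => by ring
  simp only [e, Finset.sum_sub_distrib, Finset.sum_add_distrib, ← Finset.mul_sum]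
  rw [Finset.sum_product' (f := fun i j => w i * Y i ^ 2 * w j),
    Finset.sum_product' (f := fun i j => w i * (w j * Y j ^ 2)),
    Finset.sum_product' (f := fun i j => w i * Y i * (w j * Y j))]
  simp only [← Finset.mul_sum, ← Finset.sum_mul, hw, hY]
  ring

namespace IsGibbs

variable {ψ : ℕ → Subshift A → ℝ} {C q G : ℝ} {p : ℕ} {P : ℝ → ℝ} {ν : Measure (Subshift A)}

theorem integral_comp (hν : IsGibbs ψ P q G ν) (hm : 2 ≤ m) {n : ℕ} {f : Subshift A → ℝ}
    (hf : ∀ x y, Agree n x y → f x = f y) (k : ℕ) :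
    ∫ x, f (shift^[k] x) ∂ν = ∫ x, f x ∂ν := by
  have hk := hν.measurePreserving.iterate k
  conv_rhs => rw [← hk.map_eq]
  rw [integral_map hk.measurable.aemeasurable]
  exact (continuous_of_agree hm hf).aestronglyMeasurable

/-- The law of the first `n` letters and of the `n` letters after a gap of length `p` dominates a
multiple of the product of the marginals. -/
theorem exists_mul_le (hν : IsGibbs ψ P q G ν) (h : AlmostAdditive ψ C) (p : ℕ) :
    ∃ c : ℝ, 0 < c ∧ c ≤ 1 ∧ ∀ (n : ℕ) (x y z : Subshift A), Agree n x z → shift^[n + p] z = y →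
      c * (ν.real (cyl n x) * ν.real (cyl n y)) ≤ ν.real (cyl (n + p + n) z) := by
  obtain ⟨D, hD, hd⟩ := h.exists_glue_bound p
  -- Three Gibbs bounds give `3 * G`, gluing gives `|q| * D`, and the bridge adds `p` letters. The
  -- absolute value ensures `c ≤ 1`.
  refine ⟨Real.exp (-|3 * G + |q| * D + p * P q|), Real.exp_pos _, Real.exp_le_one_iff.2 (by simp),
    fun n x y z hx hy => ?_⟩
  have e := abs_le.1 (AlmostAdditive.mul_le_of_abs le_rfl (hd n n x y z hx hy) (q := q))
  calc _ ≤ Real.exp (-|3 * G + |q| * D + p * P q|) * (Real.exp (q * ψ n x - n * P q + G) *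
        Real.exp (q * ψ n y - n * P q + G)) := by
        gcongr
        exacts [hν.cyl_le n x, hν.cyl_le n y]
    _ ≤ Real.exp (q * ψ (n + p + n) z - (n + p + n : ℕ) * P q - G) := by
      rw [← Real.exp_add, ← Real.exp_add, Real.exp_le_exp]
      push_cast
      linarith [le_abs_self (3 * G + |q| * D + p * P q), e.1]
    _ ≤ _ := hν.le_cyl _ _

/-- The pair formed by a point and its image under `shift^[n + p]` has block law at least `c` times
the product law, for which the mean square of the difference is twice the variance. -/
theorem two_mul_variance_le (hν : IsGibbs ψ P q G ν) (hm : 2 ≤ m) (hp : HasGluing A p)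
    {c : ℝ} (hc : ∀ (n : ℕ) (x y z : Subshift A), Agree n x z →
      shift^[n + p] z = y → c * (ν.real (cyl n x) * ν.real (cyl n y)) ≤ ν.real (cyl (n + p + n) z))
    {n : ℕ} {Y : Subshift A → ℝ} (hY : ∀ x y, Agree n x y → Y x = Y y)
    (hY0 : ∫ x, Y x ∂ν = 0) :
    2 * c * ∫ x, Y x ^ 2 ∂ν ≤ ∫ x, (Y x - Y (shift^[n + p] x)) ^ 2 ∂ν := by
  have := hν.prob
  have hloc : ∀ x y, Agree (n + p + n) x y →
      (Y x - Y (shift^[n + p] x)) ^ 2 = (Y y - Y (shift^[n + p] y)) ^ 2 := fun x y hxy => by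
    have h2 := agree_add_iff.1 hxy
    rw [hY x y (h2.1.mono (Nat.le_add_right n p)), hY _ _ h2.2]
  have h1 : ∑ x ∈ reps A n, ν.real (cyl n x) = 1 := by
    have := integral_eq_sum hm ν (n := n) (f := fun _ => 1) (fun _ _ _ => rfl)
    simpa using this.symm
  have h0 : ∑ x ∈ reps A n, ν.real (cyl n x) * Y x = 0 := by
    rw [← integral_eq_sum hm ν hY, hY0]
  rw [integral_eq_sum hm ν hloc, integral_eq_sum hm ν (n := n) (f := fun x => Y x ^ 2)
    (fun x y hxy => by rw [hY x y hxy]), mul_comm 2 c, mul_assoc,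
    ← sum_sum_mul_sub_sq _ _ _ h1 h0, Finset.mul_sum]
  choose g hg using hp
  refine sum_le_sum_of_injOn (F := fun x => rep (n + p + n) (g n x.1 x.2))
    (fun x _ => rep_mem_reps _ _) ?_ ?_ ?_
  · rintro ⟨x, y⟩ hxy ⟨x', y'⟩ hxy' heq
    simp only [Finset.coe_product, Set.mem_prod, Finset.mem_coe] at hxy hxy'
    obtain ⟨h1, h2⟩ := agree_add_iff.1 (agree_of_rep_eq heq)
    simp only at h1 h2
    rw [(hg _ _ _).2, (hg _ _ _).2] at h2
    have h1' := h1.mono (Nat.le_add_right n p)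
    exact Prod.ext (reps_eq_of_agree hxy.1 hxy'.1
      (((hg _ _ _).1.trans h1').trans (hg _ _ _).1.symm)) (reps_eq_of_agree hxy.2 hxy'.2 h2)
  · rintro ⟨x, y⟩ _
    simp only
    have hr := agree_rep (n + p + n) (g n x y)
    have hcyl : cyl (n + p + n) (rep (n + p + n) (g n x y)) = cyl (n + p + n) (g n x y) :=
      Set.ext fun w => ⟨fun hw => hr.symm.trans hw, fun hw => hr.trans hw⟩
    rw [hloc _ _ hr, hcyl, (hg n x y).2, ← hY _ _ (hg n x y).1, ← mul_assoc]
    gcongr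
    exact hc n x y _ (hg n x y).1 (hg n x y).2
  · intro _ _; positivity

/-- The variance of `ψ n` under `ν`. -/
noncomputable def _root_.MatrixPressure.varianceAt (ψ : ℕ → Subshift A → ℝ)
    (ν : Measure (Subshift A)) (n : ℕ) : ℝ := ∫ x, (ψ n x - ∫ y, ψ n y ∂ν) ^ 2 ∂ν

/-- By the parallelogram identity, the lower bound on the difference of the two blocks bounds the
second moment of their sum by `4 - 2 * c` times the variance. The error `D` of gluing is absorbed by
Young's inequality. -/
theorem exists_varianceAt_le (hν : IsGibbs ψ P q G ν) (hm : 2 ≤ m) (h : AlmostAdditive ψ C)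
    (hp : HasGluing A p) : ∃ c K : ℝ, 0 < c ∧ c ≤ 1 ∧ 0 ≤ K ∧ ∀ n : ℕ,
      varianceAt ψ ν (n + p + n) ≤ (4 - c) * varianceAt ψ ν n + K := by
  have := hν.prob
  obtain ⟨c, hc0, hc1, hc⟩ := hν.exists_mul_le h p
  obtain ⟨D, hD, hd⟩ := h.exists_glue_bound p
  refine ⟨c, (1 + 4 / c) * D ^ 2, hc0, hc1, by positivity, fun n => ?_⟩
  set e := ∫ y, ψ n y ∂ν with he
  set N := n + p + n with hN
  set Y : Subshift A → ℝ := fun x => ψ n x - e with hYdef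
  have hY : ∀ x y, Agree n x y → Y x = Y y := fun x y hxy => by
    simp only [hYdef, h.eq_of_agree n x y hxy]
  have hψi : ∀ k, Integrable (ψ k) ν := fun k => integrable_of_agree hm ν (h.eq_of_agree k)
  have hY0 : ∫ x, Y x ∂ν = 0 := by
    simp only [hYdef]
    rw [integral_sub (hψi n) (integrable_const _)]
    simp [he]
  have hYT : ∀ x y, Agree N x y → Y (shift^[n + p] x) = Y (shift^[n + p] y) := fun x y hxy =>
    hY _ _ (agree_add_iff.1 hxy).2
  have hYN : ∀ x y, Agree N x y → Y x = Y y := fun x y hxy => hY _ _ (hxy.mono (by omega))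
  have hInt : ∀ F : ℝ → ℝ → ℝ, Integrable (fun x => F (Y x) (Y (shift^[n + p] x))) ν := fun F =>
    integrable_of_agree hm ν (n := N) fun x y hxy => by rw [hYN x y hxy, hYT x y hxy]
  have h2 := hν.two_mul_variance_le hm hp hc hY hY0
  have h3 : ∫ x, Y (shift^[n + p] x) ^ 2 ∂ν = ∫ x, Y x ^ 2 ∂ν :=
    hν.integral_comp hm (f := fun x => Y x ^ 2) (n := n) (fun x y hxy => by rw [hY x y hxy]) _
  have h4 : ∫ x, (Y x + Y (shift^[n + p] x)) ^ 2 ∂ν + ∫ x, (Y x - Y (shift^[n + p] x)) ^ 2 ∂ν =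
      4 * ∫ x, Y x ^ 2 ∂ν := by
    rw [← integral_add (hInt fun a b => (a + b) ^ 2) (hInt fun a b => (a - b) ^ 2)]
    calc _ = ∫ x, (2 * Y x ^ 2 + 2 * Y (shift^[n + p] x) ^ 2) ∂ν := by
          congr 1; ext x; ring
      _ = _ := by
        rw [integral_add (hInt fun a _ => 2 * a ^ 2) (hInt fun _ b => 2 * b ^ 2),
          integral_const_mul, integral_const_mul, h3]
        ring
  have hv : varianceAt ψ ν n = ∫ x, Y x ^ 2 ∂ν := rfl
  have hv0 : 0 ≤ varianceAt ψ ν n := integral_nonneg fun x => sq_nonneg _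
  -- The variance is the least second moment about a constant, so the more convenient centre `2 * e`
  -- may be used.
  have hmin : varianceAt ψ ν N ≤ ∫ x, (ψ N x - 2 * e) ^ 2 ∂ν := by
    set a := ∫ y, ψ N y ∂ν with ha
    have hi : ∀ F : ℝ → ℝ, Integrable (fun x => F (ψ N x)) ν := fun F =>
      integrable_of_agree hm ν (n := N) fun x y hxy => by rw [h.eq_of_agree N x y hxy]
    have : ∫ x, (ψ N x - 2 * e) ^ 2 ∂ν = varianceAt ψ ν N + (a - 2 * e) ^ 2 := by
      calc _ = ∫ x, ((ψ N x - a) ^ 2 + (2 * (a - 2 * e) * (ψ N x - a) + (a - 2 * e) ^ 2)) ∂ν := by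
            congr 1; ext x; ring
        _ = _ := by
          rw [integral_add (hi fun t => (t - a) ^ 2)
            (hi fun t => 2 * (a - 2 * e) * (t - a) + (a - 2 * e) ^ 2),
            integral_add (hi fun t => 2 * (a - 2 * e) * (t - a)) (integrable_const _),
            integral_const_mul, integral_sub (hψi N) (integrable_const _)]
          simp [varianceAt, ← ha]
    nlinarith [sq_nonneg (a - 2 * e)]
  have hcmp : ∀ x, (ψ N x - 2 * e) ^ 2 ≤ (1 + c / 4) * (Y x + Y (shift^[n + p] x)) ^ 2 +
      (1 + 4 / c) * D ^ 2 := by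
    intro x
    have e1 := abs_le.1 (hd n n x _ x (Agree.refl n x) rfl)
    set u := Y x + Y (shift^[n + p] x) with hu
    set r := ψ N x - ψ n x - ψ n (shift^[n + p] x) with hr
    have e2 : ψ N x - 2 * e = u + r := by simp only [hu, hr, hYdef]; ring
    have e3 : r ^ 2 ≤ D ^ 2 := sq_le_sq' e1.1 e1.2
    -- The weight `c / 4` is chosen so that `(1 + c / 4) * (4 - 2 * c) ≤ 4 - c`.
    have e4 : 2 * (u * r) ≤ c / 4 * u ^ 2 + 4 / c * r ^ 2 := by
      have : 0 ≤ c / 4 * (u - 4 / c * r) ^ 2 := by positivity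
      have e5 : c / 4 * (u - 4 / c * r) ^ 2 = c / 4 * u ^ 2 + 4 / c * r ^ 2 - 2 * (u * r) := by
        field_simp; ring
      linarith
    have e6 : 4 / c * r ^ 2 ≤ 4 / c * D ^ 2 := by gcongr
    rw [e2]
    nlinarith
  have hI : ∫ x, (ψ N x - 2 * e) ^ 2 ∂ν ≤
      (1 + c / 4) * ∫ x, (Y x + Y (shift^[n + p] x)) ^ 2 ∂ν + (1 + 4 / c) * D ^ 2 := by
    have hi2 := (hInt fun a b => (a + b) ^ 2).const_mul (1 + c / 4)
    calc _ ≤ ∫ x, ((1 + c / 4) * (Y x + Y (shift^[n + p] x)) ^ 2 + (1 + 4 / c) * D ^ 2) ∂ν := by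
          refine integral_mono ?_ (hi2.add (integrable_const _)) hcmp
          exact integrable_of_agree hm ν (n := N) fun x y hxy => by rw [h.eq_of_agree N x y hxy]
      _ = _ := by
        rw [integral_add hi2 (integrable_const _), integral_const_mul]
        simp
  have h5 : ∫ x, (Y x + Y (shift^[n + p] x)) ^ 2 ∂ν ≤ (4 - 2 * c) * varianceAt ψ ν n := by
    rw [hv]; linarith
  have h6 : (1 + c / 4) * ∫ x, (Y x + Y (shift^[n + p] x)) ^ 2 ∂ν ≤
      (1 + c / 4) * ((4 - 2 * c) * varianceAt ψ ν n) := by gcongr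
  nlinarith [mul_nonneg (sq_nonneg c) hv0]

theorem frequently_varianceAt_le (hν : IsGibbs ψ P q G ν) (hm : 2 ≤ m) (h : AlmostAdditive ψ C)
    (hp : HasGluing A p) {ε : ℝ} (hε : 0 < ε) (n₀ : ℕ) :
    ∃ n ≥ n₀, 0 < n ∧ varianceAt ψ ν n ≤ ε * n ^ 2 := by
  obtain ⟨c, K, hc0, hc1, hK, hrec⟩ := hν.exists_varianceAt_le hm h hp
  let N : ℕ → ℕ := fun j => Nat.rec (motive := fun _ => ℕ) 1 (fun _ n => n + p + n) j
  have hN : ∀ j, N (j + 1) = N j + p + N j := fun _ => rfl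
  have hN2 : ∀ j, 2 ^ j ≤ N j := by
    intro j
    induction j with
    | zero => exact le_rfl
    | succ j ih => rw [hN, pow_succ]; omega
  -- Adding `K` makes the recursion purely multiplicative, because `4 - c ≥ 2`.
  have hv : ∀ j, varianceAt ψ ν (N j) + K ≤ (4 - c) ^ j * (varianceAt ψ ν (N 0) + K) := by
    intro j
    induction j with
    | zero => simp
    | succ j ih =>
      calc _ ≤ (4 - c) * (varianceAt ψ ν (N j) + K) := by
            have := hrec (N j)
            rw [← hN] at this
            nlinarith
        _ ≤ (4 - c) * ((4 - c) ^ j * (varianceAt ψ ν (N 0) + K)) := by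
            have : 0 ≤ 4 - c := by linarith
            gcongr
        _ = _ := by ring
  have ht : Tendsto (fun j : ℕ => ((4 - c) / 4) ^ j * (varianceAt ψ ν (N 0) + K)) atTop (𝓝 0) := by
    have := (tendsto_pow_atTop_nhds_zero_of_lt_one (r := (4 - c) / 4)
      (by linarith) (by linarith)).mul_const (varianceAt ψ ν (N 0) + K)
    simpa using this
  obtain ⟨j, hj, hjn⟩ := ((ht.eventually (gt_mem_nhds hε)).and (eventually_ge_atTop n₀)).exists
  refine ⟨N j, hjn.trans (Nat.lt_two_pow_self.le.trans (hN2 j)),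
    (pow_pos two_pos j).trans_le (hN2 j), ?_⟩
  have h4 : (4 : ℝ) ^ j ≤ ((N j : ℕ) : ℝ) ^ 2 := by
    have : ((2 : ℝ) ^ j) ≤ ((N j : ℕ) : ℝ) := by exact_mod_cast hN2 j
    calc (4 : ℝ) ^ j = ((2 : ℝ) ^ j) ^ 2 := by rw [← pow_mul, mul_comm, pow_mul]; norm_num
      _ ≤ _ := by gcongr
  calc varianceAt ψ ν (N j) ≤ (4 - c) ^ j * (varianceAt ψ ν (N 0) + K) := by linarith [hv j]
    _ = (((4 - c) / 4) ^ j * (varianceAt ψ ν (N 0) + K)) * 4 ^ j := by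
      rw [div_pow]; field_simp
    _ ≤ ε * 4 ^ j := by gcongr
    _ ≤ _ := by gcongr

end IsGibbs

/-! ### Differentiability of the pressure -/

theorem exp_le_one_add_add_sq_mul_exp (z : ℝ) :
    Real.exp z ≤ 1 + z + z ^ 2 * Real.exp |z| := by
  have := Complex.norm_exp_sub_sum_le_norm_mul_exp (z : ℂ) 2
  simp only [Finset.sum_range_succ, Finset.sum_range_zero, zero_add, pow_zero, pow_one,
    Nat.factorial_zero, Nat.factorial_one, Nat.cast_one, div_one, Complex.norm_real,
    Real.norm_eq_abs, sq_abs] at this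
  rw [← Complex.ofReal_exp, ← Complex.ofReal_one, ← Complex.ofReal_add, ← Complex.ofReal_sub,
    Complex.norm_real, Real.norm_eq_abs] at this
  linarith [le_abs_self (Real.exp z - (1 + z))]

namespace IsGibbs

variable {ψ : ℕ → Subshift A → ℝ} {C q G : ℝ} {p : ℕ} {P : ℝ → ℝ} {ν : Measure (Subshift A)}

/-- The Gibbs bounds turn the integral into `exp (-(n * P q))` times the partition function at `q +
t`. -/
theorem exists_integral_exp_bound (hν : IsGibbs ψ P q G ν) (hm : 2 ≤ m)
    (h : AlmostAdditive ψ C) (hP : IsPressure ψ P) : ∃ c : ℝ, ∀ t, |t| ≤ 1 → ∀ n : ℕ,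
      Real.exp (n * (P (q + t) - P q) - c) ≤ ∫ x, Real.exp (t * ψ n x) ∂ν ∧
      ∫ x, Real.exp (t * ψ n x) ∂ν ≤ Real.exp (n * (P (q + t) - P q) + c) := by
  have := hν.prob
  obtain ⟨c, hc0, hc⟩ := hP.exists_bound (|q| + 1)
  refine ⟨c + G, fun t ht n => ?_⟩
  have hb := hc (q + t) ((abs_add_le q t).trans (by linarith)) n
  rw [integral_eq_sum hm ν (n := n) (f := fun x => Real.exp (t * ψ n x))
    (fun x y hxy => by rw [h.eq_of_agree n x y hxy])]
  constructor
  · calc _ = Real.exp (-(n * P q) - G) * Real.exp (n * P (q + t) - c) := by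
          rw [← Real.exp_add]; congr 1; ring
      _ ≤ Real.exp (-(n * P q) - G) * partitionFn ψ (q + t) n := by gcongr; exact hb.2
      _ ≤ _ := by
        rw [partitionFn, Finset.mul_sum]
        refine Finset.sum_le_sum fun x _ => ?_
        calc _ = Real.exp (q * ψ n x - n * P q - G) * Real.exp (t * ψ n x) := by
              rw [← Real.exp_add, ← Real.exp_add]; congr 1; ring
          _ ≤ _ := by gcongr; exact hν.le_cyl n x
  · calc _ ≤ Real.exp (-(n * P q) + G) * partitionFn ψ (q + t) n := by
          rw [partitionFn, Finset.mul_sum]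
          refine Finset.sum_le_sum fun x _ => ?_
          calc _ ≤ Real.exp (q * ψ n x - n * P q + G) * Real.exp (t * ψ n x) := by
                gcongr; exact hν.cyl_le n x
            _ = _ := by rw [← Real.exp_add, ← Real.exp_add]; congr 1; ring
      _ ≤ Real.exp (-(n * P q) + G) * Real.exp (n * P (q + t) + c) := by gcongr; exact hb.1
      _ = _ := by rw [← Real.exp_add]; congr 1; ring

/-- In the second-order Taylor bound around the mean, the linear term integrates to zero and the
quadratic one to the variance. -/
theorem integral_exp_le (hν : IsGibbs ψ P q G ν) (hm : 2 ≤ m) (h : AlmostAdditive ψ C)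
    {n : ℕ} {t B : ℝ} (hB : ∀ x, |t * (ψ n x - ∫ y, ψ n y ∂ν)| ≤ B) :
    ∫ x, Real.exp (t * ψ n x) ∂ν ≤
      Real.exp (t * ∫ y, ψ n y ∂ν) * (1 + t ^ 2 * Real.exp B * varianceAt ψ ν n) := by
  have := hν.prob
  set e := ∫ y, ψ n y ∂ν with he
  have hi : ∀ F : ℝ → ℝ, Integrable (fun x => F (ψ n x)) ν := fun F =>
    integrable_of_agree hm ν (n := n) fun x y hxy => by rw [h.eq_of_agree n x y hxy]
  calc ∫ x, Real.exp (t * ψ n x) ∂ν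
      ≤ ∫ x, Real.exp (t * e) *
        (1 + t * (ψ n x - e) + t ^ 2 * Real.exp B * (ψ n x - e) ^ 2) ∂ν := by
        refine integral_mono (hi fun a => Real.exp (t * a)) (hi fun a => Real.exp (t * e) *
          (1 + t * (a - e) + t ^ 2 * Real.exp B * (a - e) ^ 2)) fun x => ?_
        simp only
        rw [show t * ψ n x = t * e + t * (ψ n x - e) by ring, Real.exp_add]
        gcongr
        refine (exp_le_one_add_add_sq_mul_exp _).trans ?_
        have : (t * (ψ n x - e)) ^ 2 * Real.exp |t * (ψ n x - e)| ≤
            (t * (ψ n x - e)) ^ 2 * Real.exp B := by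
          gcongr; exact hB x
        nlinarith
    _ = _ := by
      rw [integral_const_mul, integral_add (hi fun a => 1 + t * (a - e))
        (hi fun a => t ^ 2 * Real.exp B * (a - e) ^ 2), integral_const_mul,
        integral_add (integrable_const _) (hi fun a => t * (a - e)), integral_const_mul,
        integral_sub (hi fun a => a) (integrable_const _)]
      simp [varianceAt, ← he]

/-- For suitable `n` depending on `s`, the transforms at `± s / n` are at most `2 * exp (± (s / n) *
e)`. Multiplying the two estimates cancels the mean `e`, while convexity bounds the sum of the two
pressure increments times `n` below by `s * (b - a)`. -/
theorem exists_hasDerivAt [Nonempty (Subshift A)] (hν : IsGibbs ψ P q G ν) (hm : 2 ≤ m)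
    (h : AlmostAdditive ψ C) (hp : HasGluing A p) (hP : IsPressure ψ P) :
    ∃ α, HasDerivAt P α q := by
  have := hν.prob
  have hconv := hP.convexOn
  have hq : q ∈ interior (Set.univ : Set ℝ) := by simp
  set a := derivWithin P (Set.Iio q) q
  set b := derivWithin P (Set.Ioi q) q
  have hra : ∀ t > 0, t * b ≤ P (q + t) - P q := fun t ht => by
    have := hconv.rightDeriv_le_slope_of_mem_interior hq (Set.mem_univ (q + t)) (by linarith)
    rw [slope_def_field, le_div_iff₀ (by linarith)] at this
    linarith
  have hla : ∀ t > 0, -t * a ≤ P (q + -t) - P q := fun t ht => by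
    have := hconv.slope_le_leftDeriv_of_mem_interior (Set.mem_univ (q + -t)) hq (by linarith)
    rw [slope_def_field, div_le_iff₀ (by linarith)] at this
    linarith
  have hab : a ≤ b := hconv.leftDeriv_le_rightDeriv_of_mem_interior hq
  obtain ⟨c, hc⟩ := hν.exists_integral_exp_bound hm h hP
  have hC : 0 ≤ C := (abs_nonneg _).trans (h.abs_add_le 0 0 (Classical.arbitrary _))
  obtain ⟨L, hL0, hL⟩ := h.exists_linear_bound hC
  have key : ∀ s > 0, s * (b - a) ≤ 2 * c + 2 * Real.log 2 := by
    intro s hs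
    -- This `ε` makes the quadratic term at most `1`, and `n ≥ ⌈s⌉₊` keeps the perturbation `s / n`
    -- within `[0, 1]`.
    obtain ⟨n, hn, hn0, hv⟩ := hν.frequently_varianceAt_le hm h hp
      (ε := (s ^ 2 * Real.exp (s * (4 * L)))⁻¹) (by positivity) ⌈s⌉₊
    have hsn : s ≤ n := (Nat.le_ceil s).trans (by exact_mod_cast hn)
    have hn1 : (1 : ℝ) ≤ n := by exact_mod_cast hn0
    have hnpos : (0 : ℝ) < n := by linarith
    set e := ∫ y, ψ n y ∂ν with he
    have hen : |e| ≤ L * (n + 1) := by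
      have := norm_integral_le_of_norm_le_const (μ := ν) (f := ψ n) (C := L * (n + 1))
        (Eventually.of_forall fun x => hL n x)
      simpa using this
    have hup : ∀ t, |t| = s / n → ∫ x, Real.exp (t * ψ n x) ∂ν ≤ 2 * Real.exp (t * e) := by
      intro t ht
      have hB : ∀ x, |t * (ψ n x - e)| ≤ s * (4 * L) := fun x => by
        rw [abs_mul, ht]
        have : |ψ n x - e| ≤ 4 * L * n := by
          have h1 := abs_sub (ψ n x) e
          have h2 := hL n x
          nlinarith
        calc _ ≤ s / n * (4 * L * n) := by gcongr
          _ = _ := by field_simp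
      have h1 := hν.integral_exp_le hm h hB
      have h2 : t ^ 2 * Real.exp (s * (4 * L)) * varianceAt ψ ν n ≤ 1 := by
        rw [← sq_abs, ht]
        calc _ ≤ (s / n) ^ 2 * Real.exp (s * (4 * L)) *
              ((s ^ 2 * Real.exp (s * (4 * L)))⁻¹ * n ^ 2) := by gcongr
          _ = 1 := by field_simp
      rw [← he] at h1
      nlinarith [Real.exp_pos (t * e)]
    have hs1 : s / n ≤ 1 := (div_le_one hnpos).2 hsn
    have hsp : 0 < s / n := by positivity
    have e1 := ((hc (s / n) (by rwa [abs_of_pos hsp]) n).1).trans (hup _ (abs_of_pos hsp))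
    have e2 := ((hc (-(s / n)) (by rwa [abs_neg, abs_of_pos hsp]) n).1).trans
      (hup _ (by rw [abs_neg, abs_of_pos hsp]))
    have h2 : (2 : ℝ) = Real.exp (Real.log 2) := (Real.exp_log two_pos).symm
    rw [h2, ← Real.exp_add, Real.exp_le_exp] at e1 e2
    have e3 : s * b ≤ n * (P (q + s / n) - P q) := by
      calc s * b = n * (s / n * b) := by field_simp
        _ ≤ _ := by gcongr; exact hra _ hsp
    have e4 : -s * a ≤ n * (P (q + -(s / n)) - P q) := by
      calc -s * a = n * (-(s / n) * a) := by field_simp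
        _ ≤ _ := by gcongr; exact hla _ hsp
    linarith
  have hba : b ≤ a := by
    by_contra hlt
    push Not at hlt
    have hpos : 0 < b - a := by linarith
    have := key ((|2 * c + 2 * Real.log 2| + 1) / (b - a)) (by positivity)
    rw [div_mul_cancel₀ _ hpos.ne'] at this
    linarith [le_abs_self (2 * c + 2 * Real.log 2)]
  have hr := hconv.hasDerivWithinAt_rightDeriv_of_mem_interior hq
  have hl := hconv.hasDerivWithinAt_leftDeriv_of_mem_interior hq
  refine ⟨b, ?_⟩
  have hl' : HasDerivWithinAt P b (Set.Iio q) q := by rwa [← le_antisymm hab hba]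
  rw [← hasDerivWithinAt_univ, ← Set.Iic_union_Ici (a := q)]
  exact (hasDerivWithinAt_Iio_iff_Iic.1 hl').union (hasDerivWithinAt_Ioi_iff_Ici.1 hr)

/-! ### The Gibbs measure lives on the level set -/

/-- Chernoff bound: for small `s` the increment of `P` exceeds its linear part by at most `s * ε /
2`, which leaves a geometric tail for Borel–Cantelli. The sign `τ` treats both tails at once. -/
theorem ae_eventually_lt (hν : IsGibbs ψ P q G ν) (hm : 2 ≤ m) (h : AlmostAdditive ψ C)
    (hP : IsPressure ψ P) {α : ℝ} (hα : HasDerivAt P α q) {τ : ℝ} (hτ : |τ| = 1) {ε : ℝ}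
    (hε : 0 < ε) : ∀ᵐ x ∂ν, ∀ᶠ n : ℕ in atTop, τ * (ψ n x - n * α) < n * ε := by
  have := hν.prob
  obtain ⟨c, hc⟩ := hν.exists_integral_exp_bound hm h hP
  obtain ⟨s, hs0, hs1, hs⟩ : ∃ s : ℝ, 0 < s ∧ s ≤ 1 ∧
      P (q + τ * s) - P q - τ * s * α ≤ s * (ε / 2) := by
    have h1 : HasDerivAt (fun s => P (q + τ * s)) (α * τ) 0 := by
      have h2 : HasDerivAt (fun s : ℝ => q + τ * s) τ 0 := by
        simpa using ((hasDerivAt_id (0 : ℝ)).const_mul τ).const_add q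
      have h3 : HasDerivAt P α (q + τ * 0) := by simpa using hα
      exact h3.comp (0 : ℝ) h2
    have h4 := (hasDerivAt_iff_isLittleO.1 h1).def (half_pos hε)
    obtain ⟨δ, hδ, hball⟩ := Metric.eventually_nhds_iff.1 h4
    have hpos : 0 < min (δ / 2) 1 := lt_min (by linarith) one_pos
    refine ⟨min (δ / 2) 1, hpos, min_le_right _ _, ?_⟩
    have := hball (y := min (δ / 2) 1) (by
      rw [Real.dist_eq, sub_zero, abs_of_pos hpos]
      exact (min_le_left _ _).trans_lt (by linarith))
    simp only [sub_zero, mul_zero, add_zero, smul_eq_mul, Real.norm_eq_abs, abs_of_pos hpos] at this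
    have := (le_abs_self _).trans this
    linarith
  have hτs : |τ * s| ≤ 1 := by rw [abs_mul, hτ, one_mul, abs_of_pos hs0]; exact hs1
  have hmeas : ∀ n : ℕ, ν.real {x | n * ε ≤ τ * (ψ n x - n * α)} ≤
      Real.exp c * Real.exp (-(s * (ε / 2))) ^ n := by
    intro n
    have hnn : 0 ≤ᵐ[ν] fun x => Real.exp (τ * s * ψ n x) :=
      Eventually.of_forall fun x => (Real.exp_pos _).le
    have hInt : Integrable (fun x => Real.exp (τ * s * ψ n x)) ν :=
      integrable_of_agree hm ν (n := n) fun x y hxy => by rw [h.eq_of_agree n x y hxy]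
    have hM := mul_meas_ge_le_integral_of_nonneg hnn hInt (Real.exp (s * (n * ε) + τ * s * (n * α)))
    have hsub : {x | n * ε ≤ τ * (ψ n x - n * α)} ⊆
        {x | Real.exp (s * (n * ε) + τ * s * (n * α)) ≤ Real.exp (τ * s * ψ n x)} := fun x hx => by
      simp only [Set.mem_ofPred_eq, Real.exp_le_exp] at hx ⊢
      nlinarith
    have h1 := measureReal_mono hsub (measure_ne_top ν _)
    have h2 := (hc (τ * s) hτs n).2
    have h3 : Real.exp (s * (n * ε) + τ * s * (n * α)) *
        ν.real {x | n * ε ≤ τ * (ψ n x - n * α)} ≤ Real.exp (n * (P (q + τ * s) - P q) + c) :=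
      (mul_le_mul_of_nonneg_left h1 (Real.exp_pos _).le).trans (hM.trans h2)
    have h4 : Real.exp (n * (P (q + τ * s) - P q) + c) ≤
        Real.exp (s * (n * ε) + τ * s * (n * α)) *
          (Real.exp c * Real.exp (-(s * (ε / 2))) ^ n) := by
      rw [← Real.exp_nat_mul, ← Real.exp_add, ← Real.exp_add, Real.exp_le_exp]
      have := mul_le_mul_of_nonneg_left hs (Nat.cast_nonneg (α := ℝ) n)
      linarith
    exact le_of_mul_le_mul_left (h3.trans h4) (Real.exp_pos _)
  have hsum : Summable fun n : ℕ => Real.exp c * Real.exp (-(s * (ε / 2))) ^ n :=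
    (summable_geometric_of_lt_one (Real.exp_pos _).le
      (Real.exp_lt_one_iff.2 (by have := mul_pos hs0 (half_pos hε); linarith))).mul_left _
  have hfin : ∑' n : ℕ, ν {x | n * ε ≤ τ * (ψ n x - n * α)} ≠ ⊤ := by
    refine ne_top_of_le_ne_top hsum.tsum_ofReal_ne_top (ENNReal.tsum_le_tsum fun n => ?_)
    rw [← ENNReal.ofReal_toReal (measure_ne_top ν _)]
    exact ENNReal.ofReal_le_ofReal (hmeas n)
  filter_upwards [ae_eventually_notMem hfin] with x hx
  filter_upwards [hx] with n hn
  simpa using hn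

theorem ae_tendsto (hν : IsGibbs ψ P q G ν) (hm : 2 ≤ m) (h : AlmostAdditive ψ C)
    (hP : IsPressure ψ P) {α : ℝ} (hα : HasDerivAt P α q) :
    ∀ᵐ x ∂ν, Tendsto (fun n : ℕ => ψ n x / n) atTop (𝓝 α) := by
  have h1 : ∀ᵐ x ∂ν, ∀ k : ℕ, ∀ᶠ n : ℕ in atTop,
      1 * (ψ n x - n * α) < n * (1 / ((k : ℝ) + 1)) :=
    ae_all_iff.2 fun k => hν.ae_eventually_lt hm h hP hα (by simp) (by positivity)
  have h2 : ∀ᵐ x ∂ν, ∀ k : ℕ, ∀ᶠ n : ℕ in atTop,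
      (-1) * (ψ n x - n * α) < n * (1 / ((k : ℝ) + 1)) :=
    ae_all_iff.2 fun k => hν.ae_eventually_lt hm h hP hα (by simp) (by positivity)
  filter_upwards [h1, h2] with x hx1 hx2
  rw [Metric.tendsto_atTop']
  intro ε hε
  obtain ⟨k, hk⟩ := exists_nat_one_div_lt hε
  obtain ⟨N, hN⟩ := eventually_atTop.1 ((hx1 k).and ((hx2 k).and (eventually_gt_atTop 0)))
  refine ⟨N, fun n hn => ?_⟩
  obtain ⟨e1, e2, e3⟩ := hN n hn.le
  have hn' : (0 : ℝ) < n := by exact_mod_cast e3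
  rw [Real.dist_eq, show ψ n x / n - α = (ψ n x - n * α) / n by field_simp, abs_div,
    abs_of_pos hn', div_lt_iff₀ hn', abs_lt]
  have : (n : ℝ) * (1 / ((k : ℝ) + 1)) < ε * n := by nlinarith
  constructor <;> linarith

end IsGibbs

/-! ### Hausdorff dimension of the level sets -/

/-- The points at which `ψ n` is within `n * ε` of `n * α` for all `n ≥ k`. -/
def nearLevel (ψ : ℕ → Subshift A → ℝ) (α ε : ℝ) (k : ℕ) : Set (Subshift A) :=
  {x | ∀ n ≥ k, |ψ n x - n * α| ≤ n * ε}

theorem exists_mem_nearLevel {ψ : ℕ → Subshift A → ℝ} {α ε : ℝ} (hε : 0 < ε) {x : Subshift A}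
    (hx : Tendsto (fun n : ℕ => ψ n x / n) atTop (𝓝 α)) : ∃ k, x ∈ nearLevel ψ α ε k := by
  obtain ⟨N, hN⟩ := Metric.tendsto_atTop.1 hx ε hε
  refine ⟨N + 1, fun n hn => ?_⟩
  have hn' : (0 : ℝ) < n := by exact_mod_cast (by omega : 0 < n)
  have := hN n (by omega)
  rw [Real.dist_eq, show ψ n x / n - α = (ψ n x - n * α) / n by field_simp, abs_div,
    abs_of_pos hn', div_lt_iff₀ hn'] at this
  linarith

theorem ediam_cyl_le (hm : 2 ≤ m) (n : ℕ) (x : Subshift A) :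
    Metric.ediam (cyl n x) ≤ ENNReal.ofReal (((m : ℝ)⁻¹) ^ (n + 1)) := by
  refine Metric.ediam_le fun y hy z hz => ?_
  rw [edist_dist]
  exact ENNReal.ofReal_le_ofReal ((dist_le_iff_agree hm).2 (Agree.trans (Agree.symm hy) hz))

theorem subset_cyl_of_ediam_le (hm : 2 ≤ m) {n : ℕ} {S : Set (Subshift A)} {x : Subshift A}
    (hx : x ∈ S) (hS : Metric.ediam S ≤ ENNReal.ofReal (((m : ℝ)⁻¹) ^ (n + 1))) : S ⊆ cyl n x := by
  intro y hy
  have := (Metric.edist_le_ediam_of_mem hx hy).trans hS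
  rw [edist_dist, ENNReal.ofReal_le_ofReal_iff (by positivity)] at this
  exact (dist_le_iff_agree hm).1 this

theorem inv_pow_rpow_eq_exp (hm : 2 ≤ m) (n : ℕ) (s : ℝ) :
    (((m : ℝ)⁻¹) ^ n) ^ s = Real.exp (-(n * (s * Real.log m))) := by
  have hm0 : (0 : ℝ) < m := by exact_mod_cast (by omega : 0 < m)
  rw [Real.rpow_def_of_pos (by positivity), Real.log_pow, Real.log_inv]
  congr 1; ring

theorem ofReal_inv_pow_rpow_eq_exp (hm : 2 ≤ m) (n : ℕ) (s : NNReal) :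
    (ENNReal.ofReal (((m : ℝ)⁻¹) ^ n)) ^ (s : ℝ) =
      ENNReal.ofReal (Real.exp (-(n * (s * Real.log m)))) := by
  rw [ENNReal.ofReal_rpow_of_nonneg (by positivity) s.coe_nonneg, inv_pow_rpow_eq_exp hm]

section

variable {ψ : ℕ → Subshift A → ℝ} {C q G : ℝ} {p : ℕ} {P : ℝ → ℝ}

-- Each counted cylinder contributes at least `exp (n * (α * q - |q| * ε))` to the partition
-- function.
open Classical in
theorem IsPressure.exists_card_le (hP : IsPressure ψ P) (q : ℝ) : ∃ c : ℝ, ∀ (α ε : ℝ) (n : ℕ),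
    ((reps A n).filter fun x => |ψ n x - n * α| ≤ n * ε).card ≤
      Real.exp (n * (-α * q + P q + |q| * ε) + c) := by
  obtain ⟨c, -, hc⟩ := hP.exists_bound |q|
  refine ⟨c, fun α ε n => ?_⟩
  set s := (reps A n).filter fun x => |ψ n x - n * α| ≤ n * ε
  calc (s.card : ℝ) = ∑ x ∈ s, 1 := by simp
    _ ≤ ∑ x ∈ s, Real.exp (n * (-α * q + |q| * ε)) * Real.exp (q * ψ n x) := by
      refine Finset.sum_le_sum fun x hx => ?_
      rw [← Real.exp_add, Real.one_le_exp_iff]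
      have := (abs_le.1 (AlmostAdditive.mul_le_of_abs le_rfl (Finset.mem_filter.1 hx).2 (q := q))).1
      linarith
    _ ≤ ∑ x ∈ reps A n, Real.exp (n * (-α * q + |q| * ε)) * Real.exp (q * ψ n x) :=
      Finset.sum_le_sum_of_subset_of_nonneg (Finset.filter_subset _ _)
        fun _ _ _ => by positivity
    _ = Real.exp (n * (-α * q + |q| * ε)) * partitionFn ψ q n := by
      rw [partitionFn, Finset.mul_sum]
    _ ≤ Real.exp (n * (-α * q + |q| * ε)) * Real.exp (n * P q + c) := by
      gcongr; exact (hc q le_rfl n).1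
    _ = _ := by rw [← Real.exp_add]; congr 1; ring

theorem AlmostAdditive.rep_mem_filter (h : AlmostAdditive ψ C) {α ε : ℝ} {k n : ℕ} (hn : k ≤ n)
    {x : Subshift A} (hx : x ∈ nearLevel ψ α ε k) :
    rep n x ∈ reps A n ∧ |ψ n (rep n x) - n * α| ≤ n * ε :=
  ⟨rep_mem_reps n x, by rw [h.rep_eq]; exact hx n hn⟩

/-- A point of the level set supplies at least one counted cylinder at every large length, so the
exponential growth rate in the counting bound cannot be negative. -/
theorem IsPressure.legendre_nonneg (hP : IsPressure ψ P) (h : AlmostAdditive ψ C) {α : ℝ}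
    {x : Subshift A} (hx : Tendsto (fun n : ℕ => ψ n x / n) atTop (𝓝 α)) (q : ℝ) :
    0 ≤ -α * q + P q := by
  classical
  obtain ⟨c, hc⟩ := hP.exists_card_le q
  have hε : ∀ ε > 0, 0 ≤ -α * q + P q + |q| * ε := by
    intro ε hε
    obtain ⟨k, hk⟩ := exists_mem_nearLevel hε hx
    by_contra hneg
    push Not at hneg
    obtain ⟨n, hn⟩ := exists_nat_gt (|c| / -(-α * q + P q + |q| * ε))
    rw [div_lt_iff₀ (by linarith)] at hn
    have h1 : (1 : ℝ) ≤
        ((reps A (max n k)).filter fun x => |ψ (max n k) x - (max n k : ℕ) * α| ≤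
          (max n k : ℕ) * ε).card := by
      have : 0 < ((reps A (max n k)).filter fun x => |ψ (max n k) x - (max n k : ℕ) * α| ≤
          (max n k : ℕ) * ε).card := Finset.card_pos.2 ⟨rep (max n k) x,
        Finset.mem_filter.2 (h.rep_mem_filter (le_max_right n k) hk)⟩
      exact_mod_cast this
    have h2 := h1.trans (hc α ε (max n k))
    rw [Real.one_le_exp_iff] at h2
    have h3 : (n : ℝ) ≤ (max n k : ℕ) := by exact_mod_cast le_max_left n k
    nlinarith [le_abs_self c]
  refine le_of_forall_pos_le_add fun δ hδ => ?_
  have := hε (δ / (|q| + 1)) (by positivity)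
  have h4 : |q| * (δ / (|q| + 1)) ≤ δ := by
    rw [mul_div_assoc', div_le_iff₀ (by positivity)]
    nlinarith [abs_nonneg q]
  linarith

/-- The counted cylinders of length `n` cover the set, and their `s`-sums stay below `exp c`, so the
`s`-dimensional measure is finite. -/
theorem IsPressure.dimH_nearLevel_le (hm : 2 ≤ m) (hP : IsPressure ψ P) (h : AlmostAdditive ψ C)
    {α ε q : ℝ} {s : NNReal} (hs : -α * q + P q + |q| * ε ≤ s * Real.log m) (k : ℕ) :
    dimH (nearLevel ψ α ε k) ≤ s := by
  classical
  obtain ⟨c, hc⟩ := hP.exists_card_le q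
  refine dimH_le_of_hausdorffMeasure_ne_top (ne_top_of_le_ne_top
    (ENNReal.ofReal_ne_top (r := Real.exp c)) ?_)
  let ι : ℕ → Finset (Subshift A) := fun n =>
    (reps A n).filter fun x => |ψ n x - n * α| ≤ n * ε
  have hr : Tendsto (fun n : ℕ => ENNReal.ofReal (((m : ℝ)⁻¹) ^ (n + 1))) atTop (𝓝 0) := by
    simpa using ENNReal.tendsto_ofReal (tendsto_inv_pow hm)
  refine (Measure.hausdorffMeasure_le_liminf_sum (ι := fun n => ι n) (s : ℝ) (nearLevel ψ α ε k)
    _ hr (fun n x => cyl n x.1) (Eventually.of_forall fun n x => ediam_cyl_le hm n x.1) ?_).trans ?_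
  · filter_upwards [eventually_ge_atTop k] with n hn x hx
    exact Set.mem_iUnion.2
      ⟨⟨rep n x, Finset.mem_filter.2 (h.rep_mem_filter hn hx)⟩, agree_rep n x⟩
  · refine liminf_le_of_le (by isBoundedDefault) fun b hb => ?_
    obtain ⟨n, hn⟩ := hb.exists
    refine hn.trans ?_
    have hlog : 0 ≤ Real.log m := Real.log_nonneg (by exact_mod_cast (by omega : 1 ≤ m))
    calc ∑ x : ι n, Metric.ediam (cyl n x.1) ^ (s : ℝ)
        ≤ ∑ _x : ι n, ENNReal.ofReal (Real.exp (-(((n + 1 : ℕ) : ℝ) * (s * Real.log m)))) := by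
          refine Finset.sum_le_sum fun x _ => ?_
          rw [← ofReal_inv_pow_rpow_eq_exp hm]
          exact ENNReal.rpow_le_rpow (ediam_cyl_le hm n x.1) s.2
      _ = ENNReal.ofReal ((ι n).card * Real.exp (-(((n + 1 : ℕ) : ℝ) * (s * Real.log m)))) := by
          rw [ENNReal.ofReal_mul (Nat.cast_nonneg _)]
          simp
      _ ≤ ENNReal.ofReal (Real.exp c) := by
          refine ENNReal.ofReal_le_ofReal ?_
          calc _ ≤ Real.exp (n * (-α * q + P q + |q| * ε) + c) *
                Real.exp (-(((n + 1 : ℕ) : ℝ) * (s * Real.log m))) := by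
                gcongr; exact hc α ε n
            _ ≤ _ := by
              rw [← Real.exp_add, Real.exp_le_exp]
              push_cast
              have := mul_le_mul_of_nonneg_left hs (Nat.cast_nonneg (α := ℝ) n)
              have := mul_nonneg s.coe_nonneg hlog
              linarith

theorem IsPressure.dimH_le (hm : 2 ≤ m) (hP : IsPressure ψ P) (h : AlmostAdditive ψ C)
    (α q : ℝ) : dimH {x : Subshift A | Tendsto (fun n : ℕ => ψ n x / n) atTop (𝓝 α)} ≤
      ENNReal.ofReal ((-α * q + P q) / Real.log m) := by
  have hlog : 0 < Real.log m := Real.log_pos (by exact_mod_cast (by omega : 1 < m))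
  refine le_of_forall_gt fun r hr => ?_
  obtain ⟨s, hs1, hs2⟩ := ENNReal.lt_iff_exists_nnreal_btwn.1 hr
  refine lt_of_le_of_lt ?_ hs2
  have hs : -α * q + P q < s * Real.log m := by
    rw [← div_lt_iff₀ hlog]
    by_contra hle
    push Not at hle
    refine absurd hs1 (not_lt.2 ?_)
    rw [← ENNReal.ofReal_coe_nnreal]
    exact ENNReal.ofReal_le_ofReal hle
  set δ := s * Real.log m - (-α * q + P q) with hδ
  have hδ0 : 0 < δ := by linarith
  have hε : 0 < δ / (|q| + 1) := by positivity
  have h4 : |q| * (δ / (|q| + 1)) ≤ δ := by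
    rw [mul_div_assoc', div_le_iff₀ (by positivity)]
    nlinarith [abs_nonneg q]
  calc _ ≤ dimH (⋃ k, nearLevel ψ α (δ / (|q| + 1)) k) :=
        dimH_mono fun x hx => Set.mem_iUnion.2 (exists_mem_nearLevel hε hx)
    _ ≤ s := by
      rw [dimH_iUnion]
      exact iSup_le fun k => hP.dimH_nearLevel_le hm h (q := q) (by linarith) k

/-- Mass distribution principle: on a set `nearLevel ψ α ε k` of positive measure, the Gibbs bound
makes the mass of long cylinders at most a constant times the `s`-th power of their scale. -/
theorem IsGibbs.le_dimH (hm : 2 ≤ m) {ν : Measure (Subshift A)} (hν : IsGibbs ψ P q G ν)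
    (h : AlmostAdditive ψ C) {α : ℝ}
    (hae : ∀ᵐ x ∂ν, Tendsto (fun n : ℕ => ψ n x / n) atTop (𝓝 α)) :
    ENNReal.ofReal ((-α * q + P q) / Real.log m) ≤
      dimH {x : Subshift A | Tendsto (fun n : ℕ => ψ n x / n) atTop (𝓝 α)} := by
  have := hν.prob
  have hm1 : (1 : ℝ) < m := by exact_mod_cast (by omega : 1 < m)
  have hlog : 0 < Real.log m := Real.log_pos hm1
  set E := {x : Subshift A | Tendsto (fun n : ℕ => ψ n x / n) atTop (𝓝 α)}
  refine le_of_forall_lt fun r hr => ?_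
  obtain ⟨s, hs1, hs2⟩ := ENNReal.lt_iff_exists_nnreal_btwn.1 hr
  refine lt_of_lt_of_le hs1 ?_
  have hs0 : 0 < s := by
    have := (zero_le (a := r)).trans_lt hs1
    exact_mod_cast this
  have hs : s * Real.log m < -α * q + P q := by
    rw [← lt_div_iff₀ hlog]
    by_contra hle
    push Not at hle
    refine absurd hs2 (not_lt.2 ?_)
    rw [← ENNReal.ofReal_coe_nnreal]
    exact ENNReal.ofReal_le_ofReal hle
  set δ := (-α * q + P q) - s * Real.log m with hδ
  have hδ0 : 0 < δ := by linarith
  have hε : 0 < δ / (|q| + 1) := by positivity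
  have h4 : |q| * (δ / (|q| + 1)) ≤ δ := by
    rw [mul_div_assoc', div_le_iff₀ (by positivity)]
    nlinarith [abs_nonneg q]
  set ε := δ / (|q| + 1)
  have hFm : ∀ k, MeasurableSet (nearLevel ψ α ε k) := fun k => by
    have : nearLevel ψ α ε k = ⋂ n ≥ k, {x | |ψ n x - n * α| ≤ n * ε} := by
      ext x; simp [nearLevel]
    rw [this]
    refine MeasurableSet.biInter (Set.to_countable _) fun n _ => ?_
    have hc : Continuous (ψ n) := continuous_of_agree hm (h.eq_of_agree n)
    exact (isClosed_le (by fun_prop) continuous_const).measurableSet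
  obtain ⟨k, hk⟩ : ∃ k, ν (nearLevel ψ α ε k) ≠ 0 := by
    by_contra hall
    push Not at hall
    have h0 : ν (⋃ k, nearLevel ψ α ε k) = 0 := measure_iUnion_null hall
    have h1 : ∀ᵐ x ∂ν, x ∈ ⋃ k, nearLevel ψ α ε k := by
      filter_upwards [hae] with x hx
      exact Set.mem_iUnion.2 (exists_mem_nearLevel hε hx)
    have h2 : ∀ᵐ x ∂ν, x ∉ ⋃ k, nearLevel ψ α ε k := measure_eq_zero_iff_ae_notMem.1 h0
    obtain ⟨x, hx1, hx2⟩ := (h1.and h2).exists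
    exact hx2 hx1
  set F := nearLevel ψ α ε k
  have hcyl : ∀ x ∈ F, ∀ n ≥ k, ν (cyl n x) ≤
      ENNReal.ofReal (Real.exp (G - n * (s * Real.log m))) := fun x hx n hn => by
    rw [← ENNReal.ofReal_toReal (measure_ne_top ν _)]
    refine ENNReal.ofReal_le_ofReal ((hν.cyl_le n x).trans (Real.exp_le_exp.2 ?_))
    have e1 := (abs_le.1 (AlmostAdditive.mul_le_of_abs le_rfl (hx n hn) (q := q))).2
    have e2 := mul_le_mul_of_nonneg_left h4 (Nat.cast_nonneg (α := ℝ) n)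
    nlinarith
  -- Besides `G`, the constant pays for the two scales between the exponent `n` in the mass bound of
  -- `cyl n x` and the lower bound `m ^ (-(n + 2))` for the diameter.
  set c := Real.exp (-(G + 2 * (s * Real.log m))) 
  have hle : ENNReal.ofReal c • ν.restrict F ≤ μH[(s : ℝ)] := by
    refine Measure.le_hausdorffMeasure _ _ (ENNReal.ofReal (((m : ℝ)⁻¹) ^ (k + 1)))
      (by rw [ENNReal.ofReal_pos]; positivity) fun S hS => ?_
    rw [Measure.smul_apply, smul_eq_mul, Measure.restrict_apply' (hFm k)]
    rcases Set.eq_empty_or_nonempty (S ∩ F) with hemp | ⟨x, hxS, hxF⟩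
    · rw [hemp]; simp
    have hbound : ∀ n ≥ k, Metric.ediam S ≤ ENNReal.ofReal (((m : ℝ)⁻¹) ^ (n + 1)) →
        ENNReal.ofReal c * ν (S ∩ F) ≤ (ENNReal.ofReal (((m : ℝ)⁻¹) ^ (n + 2))) ^ (s : ℝ) := by
      intro n hn hd
      calc _ ≤ ENNReal.ofReal c * ENNReal.ofReal (Real.exp (G - n * (s * Real.log m))) := by
            gcongr
            exact (measure_mono (Set.inter_subset_left.trans
              (subset_cyl_of_ediam_le hm hxS hd))).trans (hcyl x hxF n hn)
        _ = _ := by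
          rw [ofReal_inv_pow_rpow_eq_exp hm, ← ENNReal.ofReal_mul (Real.exp_pos _).le,
            ← Real.exp_add]
          congr 2; push_cast; ring
    have hSfin : Metric.ediam S ≠ ⊤ := ne_top_of_le_ne_top ENNReal.ofReal_ne_top hS
    have hy0 : 0 < (m : ℝ)⁻¹ := by positivity
    have hy1 : (m : ℝ)⁻¹ < 1 := inv_lt_one_of_one_lt₀ hm1
    -- A set of zero diameter lies in arbitrarily long cylinders, so its mass on `F` vanishes in the
    -- limit; positivity of `s` enters here.
    rcases eq_or_ne (Metric.ediam S) 0 with h0 | h0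
    · rw [h0, ENNReal.zero_rpow_of_pos (by exact_mod_cast hs0)]
      have ht : Tendsto (fun n : ℕ => (ENNReal.ofReal (((m : ℝ)⁻¹) ^ (n + 2))) ^ (s : ℝ)) atTop
          (𝓝 0) := by
        have h1 : Tendsto (fun n : ℕ => ENNReal.ofReal (((m : ℝ)⁻¹) ^ (n + 2))) atTop (𝓝 0) := by
          have := (tendsto_pow_atTop_nhds_zero_of_lt_one hy0.le hy1).comp (tendsto_add_atTop_nat 2)
          simpa using ENNReal.tendsto_ofReal this
        have h2 := (ENNReal.continuous_rpow_const (y := (s : ℝ))).tendsto 0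
        rw [ENNReal.zero_rpow_of_pos (by exact_mod_cast hs0)] at h2
        exact h2.comp h1
      refine ge_of_tendsto ht ?_
      filter_upwards [eventually_ge_atTop k] with n hn
      exact hbound n hn (by rw [h0]; exact zero_le)
    · set D := (Metric.ediam S).toReal with hD
      have hDpos : 0 < D := ENNReal.toReal_pos h0 hSfin
      have hDS : Metric.ediam S = ENNReal.ofReal D := (ENNReal.ofReal_toReal hSfin).symm
      have hDk : D ≤ ((m : ℝ)⁻¹) ^ (k + 1) := by
        rwa [hDS, ENNReal.ofReal_le_ofReal_iff (by positivity)] at hS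
      obtain ⟨n, hn1, hn2⟩ := exists_nat_pow_near_of_lt_one hDpos
        (hDk.trans (pow_le_one₀ hy0.le hy1.le)) hy0 hy1
      have hkn : k + 1 < n + 1 := by
        rw [← pow_lt_pow_iff_right_of_lt_one₀ hy0 hy1]
        exact hn1.trans_le hDk
      obtain ⟨n, rfl⟩ : ∃ l, n = l + 1 := ⟨n - 1, by omega⟩
      refine (hbound n (by omega) ?_).trans ?_
      · rw [hDS]; exact ENNReal.ofReal_le_ofReal hn2
      · rw [hDS]
        exact ENNReal.rpow_le_rpow (ENNReal.ofReal_le_ofReal hn1.le) s.2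
  refine le_dimH_of_hausdorffMeasure_ne_zero fun h0 => hk ?_
  have h1 := (hle E).trans h0.le
  rw [Measure.smul_apply, smul_eq_mul, Measure.restrict_apply' (hFm k), nonpos_iff_eq_zero,
    mul_eq_zero] at h1
  have h2 : ν (E ∩ F) = 0 := h1.resolve_left (by rw [ENNReal.ofReal_eq_zero, not_le]; exact Real.exp_pos _)
  refine measure_mono_null_ae ?_ h2
  filter_upwards [hae] with x hx hxF
  exact ⟨hx, hxF⟩

end

/-- Multifractal formalism for an almost additive potential on a subshift with gluing. -/
theorem AlmostAdditive.exists_hasDerivAt_and_dimH_eq (hm : 2 ≤ m) [Nonempty (Subshift A)]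
    {ψ : ℕ → Subshift A → ℝ} {C : ℝ} (h : AlmostAdditive ψ C) {p : ℕ} (hp : HasGluing A p)
    {P : ℝ → ℝ} (hP : IsPressure ψ P) (q : ℝ) : ∃ α : ℝ, HasDerivAt P α q ∧
      0 ≤ (-α * q + P q) / Real.log m ∧
      dimH {x : Subshift A | Tendsto (fun n : ℕ => ψ n x / n) atTop (𝓝 α)} =
        ENNReal.ofReal ((-α * q + P q) / Real.log m) := by
  obtain ⟨G, ν, hν⟩ := h.exists_isGibbs hm hp hP q
  obtain ⟨α, hα⟩ := hν.exists_hasDerivAt hm h hp hP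
  have hae := hν.ae_tendsto hm h hP hα
  have := hν.prob
  obtain ⟨x, hx⟩ := hae.exists
  have hlog : 0 ≤ Real.log m := Real.log_nonneg (by exact_mod_cast (by omega : 1 ≤ m))
  exact ⟨α, hα, div_nonneg (hP.legendre_nonneg h hx q) hlog,
    le_antisymm (hP.dimH_le hm h α q) (hν.le_dimH hm h hae)⟩

/-! ### Products of positive matrices -/

theorem entrySum_mul (B B' : Matrix (Fin d) (Fin d) ℝ) :
    entrySum (B * B') = ∑ k, (∑ i, B i k) * ∑ j, B' k j := by
  simp only [entrySum, Matrix.mul_apply, Finset.sum_mul_sum]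
  calc _ = ∑ i, ∑ k, ∑ j, B i k * B' k j := by
        refine Finset.sum_congr rfl fun i _ => Finset.sum_comm
    _ = _ := Finset.sum_comm

theorem entrySum_eq_sum_col (B : Matrix (Fin d) (Fin d) ℝ) : entrySum B = ∑ k, ∑ i, B i k :=
  Finset.sum_comm

theorem entrySum_mul_le {B B' : Matrix (Fin d) (Fin d) ℝ} (hB : ∀ i j, 0 ≤ B i j)
    (hB' : ∀ i j, 0 ≤ B' i j) : entrySum (B * B') ≤ entrySum B * entrySum B' := by
  have hB1 : ∀ k, 0 ≤ ∑ i, B i k := fun k => Finset.sum_nonneg fun i _ => hB i k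
  rw [entrySum_mul, entrySum_eq_sum_col B, Finset.sum_mul]
  refine Finset.sum_le_sum fun k _ => ?_
  refine mul_le_mul_of_nonneg_left ?_ (hB1 k)
  exact Finset.single_le_sum (f := fun k => ∑ j, B' k j)
    (fun k _ => Finset.sum_nonneg fun j _ => hB' k j) (Finset.mem_univ k)

/-- Comparable columns each carry at least the fraction `1 / (d * κ)` of the entry sum, so no
cancellation of mass occurs in the product. -/
theorem le_entrySum_mul {B B' : Matrix (Fin d) (Fin d) ℝ} (hB' : ∀ i j, 0 ≤ B' i j) {κ : ℝ}
    (hκ : ∀ k l, ∑ i, B i l ≤ κ * ∑ i, B i k) :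
    entrySum B * entrySum B' ≤ d * κ * entrySum (B * B') := by
  have h1 : ∀ k, entrySum B ≤ d * κ * ∑ i, B i k := fun k => by
    rw [entrySum_eq_sum_col]
    calc _ ≤ ∑ _l : Fin d, κ * ∑ i, B i k := Finset.sum_le_sum fun l _ => hκ k l
      _ = _ := by simp [mul_assoc]
  rw [entrySum_mul, Finset.mul_sum]
  conv_lhs => rw [entrySum.eq_def B', Finset.mul_sum]
  refine Finset.sum_le_sum fun k _ => ?_
  rw [← mul_assoc]
  exact mul_le_mul_of_nonneg_right (h1 k) (Finset.sum_nonneg fun j _ => hB' k j)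

section Cocycle

variable (M : Subshift A → Matrix (Fin d) (Fin d) ℝ)

theorem cocycle_add (n k : ℕ) (x : Subshift A) :
    cocycle M (n + k) x = cocycle M n x * cocycle M k (shift^[n] x) := by
  simp only [cocycle, List.range_add, List.map_append, List.prod_append, List.map_map]
  congr 3
  funext l
  simp only [Function.comp_apply]
  rw [add_comm n l, Function.iterate_add_apply]

theorem cocycle_zero (x : Subshift A) : cocycle M 0 x = 1 := by simp [cocycle]

theorem cocycle_one (x : Subshift A) : cocycle M 1 x = M x := by simp [cocycle]

variable {M}

theorem cocycle_nonneg (hMpos : ∀ x i j, 0 < M x i j) (n : ℕ) (x : Subshift A) (i j : Fin d) :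
    0 ≤ cocycle M n x i j := by
  induction n generalizing i j with
  | zero =>
    rw [cocycle_zero, Matrix.one_apply]
    split_ifs <;> norm_num
  | succ n ih =>
    rw [cocycle_add, cocycle_one, Matrix.mul_apply]
    exact Finset.sum_nonneg fun k _ => mul_nonneg (ih i k) (hMpos _ _ _).le

/-- A positive Hölder exponent gives continuity, and continuous entries attain their extrema on the
compact subshift. -/
theorem exists_entry_bounds (hm : 2 ≤ m) (hMpos : ∀ x i j, 0 < M x i j) (hM : IsHolder M) :
    ∃ a b : ℝ, 0 < a ∧ 0 < b ∧ ∀ x i j, a ≤ M x i j ∧ M x i j ≤ b := by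
  obtain ⟨C, r, hr, hh⟩ := hM
  have := Subshift.compactSpace (A := A) hm
  rcases isEmpty_or_nonempty (Subshift A × Fin d × Fin d) with hem | hne
  · exact ⟨1, 1, one_pos, one_pos, fun x i j => (hem.false (x, i, j)).elim⟩
  have hc : Continuous fun t : Subshift A × Fin d × Fin d => M t.1 t.2.1 t.2.2 := by
    rw [continuous_prod_of_discrete_right]
    rintro ⟨i, j⟩
    exact (hh i j).continuous hr
  obtain ⟨t, -, ht⟩ := isCompact_univ.exists_isMinOn Set.univ_nonempty hc.continuousOn
  obtain ⟨u, -, hu⟩ := isCompact_univ.exists_isMaxOn Set.univ_nonempty hc.continuousOn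
  exact ⟨_, _, hMpos t.1 t.2.1 t.2.2, hMpos u.1 u.2.1 u.2.2,
    fun x i j => ⟨ht (Set.mem_univ (x, i, j)), hu (Set.mem_univ (x, i, j))⟩⟩

theorem entrySum_cocycle_pos (hd : 1 ≤ d) (hMpos : ∀ x i j, 0 < M x i j) (n : ℕ)
    (x : Subshift A) : 0 < entrySum (cocycle M n x) := by
  have hne : Nonempty (Fin d) := ⟨⟨0, hd⟩⟩
  -- Row sums are used because the empty product is the identity, whose entries need not be
  -- positive.
  have : ∀ i, 0 < ∑ j, cocycle M n x i j := by
    induction n with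
    | zero => intro i; simp [cocycle_zero, Matrix.one_apply]
    | succ n ih =>
      intro i
      rw [cocycle_add, cocycle_one]
      obtain ⟨k, -, hk⟩ := Finset.exists_lt_of_sum_lt (f := fun _ => (0 : ℝ))
        (g := fun j => cocycle M n x i j) (s := Finset.univ) (by simpa using ih i)
      refine Finset.sum_pos (fun j _ => ?_) Finset.univ_nonempty
      rw [Matrix.mul_apply]
      exact Finset.sum_pos' (fun l _ => mul_nonneg (cocycle_nonneg hMpos _ _ _ _)
        (hMpos _ _ _).le) ⟨k, Finset.mem_univ k, mul_pos hk (hMpos _ _ _)⟩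
  exact Finset.sum_pos (fun i _ => this i) Finset.univ_nonempty

/-- The last factor alone decides the ratio of two columns, and its entries differ by a factor of at
most `b / a`. -/
theorem sum_col_cocycle_le (hMpos : ∀ x i j, 0 < M x i j) {a b : ℝ} (ha : 0 < a) (hab : a ≤ b)
    (hMab : ∀ x i j, a ≤ M x i j ∧ M x i j ≤ b) (n : ℕ) (x : Subshift A) (k l : Fin d) :
    ∑ i, cocycle M n x i l ≤ b / a * ∑ i, cocycle M n x i k := by
  cases n with
  | zero =>
    simp only [cocycle_zero, Matrix.one_apply, Finset.sum_ite_eq', Finset.mem_univ, if_true, mul_one]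
    exact (one_le_div ha).2 hab
  | succ n =>
    rw [cocycle_add, cocycle_one, Finset.mul_sum]
    refine Finset.sum_le_sum fun i _ => ?_
    rw [Matrix.mul_apply, Matrix.mul_apply, Finset.mul_sum]
    refine Finset.sum_le_sum fun t _ => ?_
    have h1 := (hMab (shift^[n] x) t l).2
    have h2 := (hMab (shift^[n] x) t k).1
    have h3 : M (shift^[n] x) t l ≤ b / a * M (shift^[n] x) t k :=
      h1.trans (by rw [div_mul_eq_mul_div, le_div_iff₀ ha]; nlinarith)
    calc _ ≤ cocycle M n x i t * (b / a * M (shift^[n] x) t k) :=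
          mul_le_mul_of_nonneg_left h3 (cocycle_nonneg hMpos _ _ _ _)
      _ = _ := by ring

theorem exists_entrySum_almost_mul (hm : 2 ≤ m) (hd : 1 ≤ d) (hMpos : ∀ x i j, 0 < M x i j)
    (hM : IsHolder M) : ∃ D : ℝ, ∀ (n k : ℕ) (x : Subshift A),
      |Real.log (entrySum (cocycle M (n + k) x)) - Real.log (entrySum (cocycle M n x)) -
        Real.log (entrySum (cocycle M k (shift^[n] x)))| ≤ D := by
  obtain ⟨a, b, ha, hb, hab⟩ := exists_entry_bounds hm hMpos hM
  have hpos := entrySum_cocycle_pos hd hMpos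
  refine ⟨|Real.log (d * (b / a))|, fun n k x => ?_⟩
  have hab' : a ≤ b := (hab x ⟨0, hd⟩ ⟨0, hd⟩).1.trans (hab x ⟨0, hd⟩ ⟨0, hd⟩).2
  have hdpos : (0 : ℝ) < d := by exact_mod_cast hd
  have h1 := entrySum_mul_le (cocycle_nonneg hMpos n x) (cocycle_nonneg hMpos k (shift^[n] x))
  have h2 := le_entrySum_mul (cocycle_nonneg hMpos k (shift^[n] x))
    (sum_col_cocycle_le hMpos ha hab' hab n x)
  rw [← cocycle_add] at h1 h2
  have h3 := Real.log_le_log (hpos _ _) h1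
  have h4 := Real.log_le_log (mul_pos (hpos _ _) (hpos _ _)) h2
  rw [Real.log_mul (hpos _ _).ne' (hpos _ _).ne'] at h3
  rw [Real.log_mul (hpos _ _).ne' (hpos _ _).ne', Real.log_mul (by positivity) (hpos _ _).ne'] at h4
  rw [abs_le]
  have := le_abs_self (Real.log (d * (b / a)))
  constructor <;> linarith [abs_nonneg (Real.log (d * (b / a)))]

/-- The factors at two agreeing points are compared entrywise: their ratio is at most the
exponential of a multiple of `θ` to the number of letters still in common. The exponents add up to a
geometric series. -/
theorem exists_distortion (hm : 2 ≤ m) (hd : 1 ≤ d) (hMpos : ∀ x i j, 0 < M x i j)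
    (hM : IsHolder M) : ∃ D : ℝ, ∀ (n : ℕ) (x y : Subshift A), Agree n x y →
      |Real.log (entrySum (cocycle M n x)) - Real.log (entrySum (cocycle M n y))| ≤ D := by
  obtain ⟨a, b, ha, hb, hab⟩ := exists_entry_bounds hm hMpos hM
  obtain ⟨C, r, hr, hh⟩ := hM
  have hm1 : (1 : ℝ) < m := by exact_mod_cast (by omega : 1 < m)
  set θ : ℝ := ((m : ℝ)⁻¹) ^ (r : ℝ) with hθ
  have hθ0 : 0 < θ := by positivity
  have hθ1 : θ < 1 := Real.rpow_lt_one (by positivity) (inv_lt_one_of_one_lt₀ hm1) (by exact_mod_cast hr)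
  have hstep : ∀ (n : ℕ) (x y : Subshift A), Agree n x y → ∀ i j,
      M x i j ≤ Real.exp (C / a * θ ^ (n + 1)) * M y i j := by
    intro n x y hxy i j
    have h1 := (hh i j).dist_le_of_le ((dist_le_iff_agree hm).2 hxy)
    have h2 : (((m : ℝ)⁻¹) ^ (n + 1)) ^ (r : ℝ) = θ ^ (n + 1) := by
      rw [hθ, ← Real.rpow_natCast, ← Real.rpow_natCast, ← Real.rpow_mul (by positivity),
        ← Real.rpow_mul (by positivity), mul_comm]
    rw [h2, Real.dist_eq] at h1
    have h3 := (abs_le.1 h1).2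
    have h4 := Real.add_one_le_exp (C / a * θ ^ (n + 1))
    have h5 : C * θ ^ (n + 1) ≤ C / a * θ ^ (n + 1) * M y i j := by
      rw [div_mul_eq_mul_div, div_mul_eq_mul_div, le_div_iff₀ ha]
      have := (hab y i j).1
      gcongr
    calc M x i j ≤ (C / a * θ ^ (n + 1) + 1) * M y i j := by linarith
      _ ≤ _ := by gcongr; exact (hMpos _ _ _).le
  have hind : ∀ (n : ℕ) (x y : Subshift A), Agree n x y → ∀ i j,
      cocycle M n x i j ≤ Real.exp (C / a * ∑ l ∈ Finset.range n, θ ^ l) * cocycle M n y i j := by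
    intro n
    induction n with
    | zero => intro x y _ i j; simp [cocycle_zero]
    | succ n ih =>
      intro x y hxy i j
      rw [add_comm n 1] at hxy
      have h2 := (agree_add_iff.1 hxy).2
      rw [add_comm n 1, cocycle_add, cocycle_add, cocycle_one, cocycle_one, Matrix.mul_apply,
        Matrix.mul_apply, Finset.mul_sum]
      refine Finset.sum_le_sum fun k _ => ?_
      have h3 : M x i k ≤ Real.exp (C / a * θ ^ n) * M y i k := by
        refine (hstep n x y (hxy.mono (by omega)) i k).trans ?_
        have := hMpos y i k
        have := pow_le_pow_of_le_one hθ0.le hθ1.le (Nat.le_succ n)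
        gcongr
      calc _ ≤ (Real.exp (C / a * θ ^ n) * M y i k) *
            (Real.exp (C / a * ∑ l ∈ Finset.range n, θ ^ l) * cocycle M n (shift^[1] y) k j) :=
            mul_le_mul h3 (ih _ _ h2 k j) (cocycle_nonneg hMpos _ _ _ _)
              (mul_nonneg (Real.exp_pos _).le (hMpos _ _ _).le)
        _ = _ := by
          rw [add_comm 1 n, Finset.sum_range_succ, mul_add, Real.exp_add]
          ring
  have hpos := entrySum_cocycle_pos hd hMpos
  have hone : ∀ (n : ℕ) (x y : Subshift A), Agree n x y →
      Real.log (entrySum (cocycle M n x)) ≤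
        C / a * (1 - θ)⁻¹ + Real.log (entrySum (cocycle M n y)) := by
    intro n x y hxy
    have h1 : entrySum (cocycle M n x) ≤
        Real.exp (C / a * (1 - θ)⁻¹) * entrySum (cocycle M n y) := by
      simp only [entrySum, Finset.mul_sum]
      refine Finset.sum_le_sum fun i _ => Finset.sum_le_sum fun j _ => ?_
      refine (hind n x y hxy i j).trans ?_
      have h0 := cocycle_nonneg hMpos n y i j
      have hs : ∑ l ∈ Finset.range n, θ ^ l ≤ (1 - θ)⁻¹ := by
        rw [← tsum_geometric_of_lt_one hθ0.le hθ1]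
        exact (summable_geometric_of_lt_one hθ0.le hθ1).sum_le_tsum _ fun l _ => by positivity
      gcongr
    have := Real.log_le_log (hpos _ _) h1
    rwa [Real.log_mul (Real.exp_pos _).ne' (hpos _ _).ne', Real.log_exp] at this
  refine ⟨C / a * (1 - θ)⁻¹, fun n x y hxy => ?_⟩
  have h1 := hone n x y hxy
  have h2 := hone n y x hxy.symm
  rw [abs_le]
  constructor <;> linarith

/-! ### The matrix product as an almost additive potential -/

variable (M) in
/-- The logarithm of the norm of the matrix product, made to depend on the first `n` letters only. -/
noncomputable def logNorm (n : ℕ) (x : Subshift A) : ℝ :=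
  Real.log (entrySum (cocycle M n (rep n x)))

theorem exists_almostAdditive_logNorm (hm : 2 ≤ m) (hd : 1 ≤ d) (hMpos : ∀ x i j, 0 < M x i j)
    (hM : IsHolder M) : ∃ C, AlmostAdditive (logNorm M) C := by
  obtain ⟨D₁, h₁⟩ := exists_entrySum_almost_mul hm hd hMpos hM
  obtain ⟨D₂, h₂⟩ := exists_distortion hm hd hMpos hM
  -- Three values are replaced by those at representatives, each at the cost of one distortion
  -- constant.
  refine ⟨D₁ + 3 * D₂, fun n x y hxy => by rw [logNorm, logNorm, rep_eq_rep hxy], fun n k x => ?_⟩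
  have e1 := abs_le.1 (h₁ n k x)
  have e2 := abs_le.1 (h₂ _ _ _ (agree_rep (n + k) x))
  have e3 := abs_le.1 (h₂ _ _ _ (agree_rep n x))
  have e4 := abs_le.1 (h₂ _ _ _ (agree_rep k (shift^[n] x)))
  simp only [logNorm]
  rw [abs_le]
  constructor <;> linarith [e1.1, e1.2, e2.1, e2.2, e3.1, e3.2, e4.1, e4.2]

theorem partitionSum_eq (q : ℝ) (n : ℕ) : partitionSum M q n =
    ∑ x ∈ reps A n, ⨆ y : cylinder A (word n x), entrySum (cocycle M n y.1) ^ q := by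
  classical
  have hinj : Set.InjOn (word n) (reps A n : Set (Subshift A)) := fun x hx y hy hxy =>
    reps_eq_of_agree hx hy (word_eq_iff.1 hxy)
  rw [partitionSum, ← Finset.sum_image (g := word n)
    (f := fun J => ⨆ y : cylinder A J, entrySum (cocycle M n y.1) ^ q) hinj]
  symm
  apply Finset.sum_subset_zero_on_sdiff
  · intro J hJ
    obtain ⟨x, -, rfl⟩ := Finset.mem_image.1 hJ
    simp only [Finset.mem_filter, Finset.mem_univ, true_and]
    exact fun k _ => x.2 k
  · intro J hJ
    have hJ' := (Finset.mem_sdiff.1 hJ).2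
    have : IsEmpty (cylinder A J) := by
      refine ⟨fun y => hJ' (Finset.mem_image.2 ⟨rep n y.1, rep_mem_reps _ _, ?_⟩)⟩
      rw [word_eq_iff.2 (agree_rep n y.1)]
      exact funext y.2
    -- A real supremum over an empty type is `0`, so words with empty cylinder do not contribute.
    exact Real.iSup_of_isEmpty _
  · exact fun _ _ => rfl

theorem abs_log_partitionSum_sub_le [Nonempty (Subshift A)] (hd : 1 ≤ d)
    (hMpos : ∀ x i j, 0 < M x i j) {D : ℝ} (hD : ∀ (n : ℕ) (x y : Subshift A), Agree n x y →
      |Real.log (entrySum (cocycle M n x)) - Real.log (entrySum (cocycle M n y))| ≤ D)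
    (q : ℝ) (n : ℕ) :
    |Real.log (partitionSum M q n) - Real.log (partitionFn (logNorm M) q n)| ≤ |q| * D := by
  have hpos := entrySum_cocycle_pos hd hMpos
  have hZ := partitionFn_pos (logNorm M) q n
  have hterm : ∀ x ∈ reps A n, ∀ y : cylinder A (word n x),
      entrySum (cocycle M n y.1) ^ q ≤ Real.exp (|q| * D) * Real.exp (q * logNorm M n x) ∧
      Real.exp (-(|q| * D)) * Real.exp (q * logNorm M n x) ≤ entrySum (cocycle M n y.1) ^ q := by
    intro x hx y
    have hag : Agree n y.1 (rep n x) := by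
      rw [rep_of_mem hx]
      exact word_eq_iff.1 (funext y.2)
    have := abs_le.1 (AlmostAdditive.mul_le_of_abs le_rfl (hD n _ _ hag) (q := q))
    rw [Real.rpow_def_of_pos (hpos _ _), ← Real.exp_add, ← Real.exp_add, Real.exp_le_exp,
      Real.exp_le_exp, logNorm]
    constructor <;> linarith [this.1, this.2]
  have hup : partitionSum M q n ≤ Real.exp (|q| * D) * partitionFn (logNorm M) q n := by
    rw [partitionSum_eq, partitionFn, Finset.mul_sum]
    refine Finset.sum_le_sum fun x hx => ?_
    have : Nonempty (cylinder A (word n x)) := ⟨⟨x, fun _ => rfl⟩⟩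
    exact ciSup_le fun y => (hterm x hx y).1
  have hlow : Real.exp (-(|q| * D)) * partitionFn (logNorm M) q n ≤ partitionSum M q n := by
    rw [partitionSum_eq, partitionFn, Finset.mul_sum]
    refine Finset.sum_le_sum fun x hx => ?_
    have hbdd : BddAbove (Set.range fun y : cylinder A (word n x) =>
        entrySum (cocycle M n y.1) ^ q) := by
      refine ⟨Real.exp (|q| * D) * Real.exp (q * logNorm M n x), ?_⟩
      rintro _ ⟨y, rfl⟩
      exact (hterm x hx y).1
    exact (hterm x hx ⟨x, fun _ => rfl⟩).2.trans
      (le_ciSup hbdd (⟨x, fun _ => rfl⟩ : cylinder A (word n x)))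
  have hS : 0 < partitionSum M q n := lt_of_lt_of_le (by positivity) hlow
  have h1 := Real.log_le_log hS hup
  have h2 := Real.log_le_log (by positivity) hlow
  rw [Real.log_mul (Real.exp_pos _).ne' hZ.ne', Real.log_exp] at h1 h2
  rw [abs_le]
  constructor <;> linarith

end Cocycle

theorem tendsto_div_of_abs_sub_le {u v : ℕ → ℝ} {D l : ℝ} (h : ∀ n, |u n - v n| ≤ D)
    (hv : Tendsto (fun n : ℕ => v n / n) atTop (𝓝 l)) :
    Tendsto (fun n : ℕ => u n / n) atTop (𝓝 l) := by
  have h0 : Tendsto (fun n : ℕ => (u n - v n) / n) atTop (𝓝 0) := by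
    refine squeeze_zero_norm (a := fun n : ℕ => D / n) (fun n => ?_)
      (tendsto_const_nhds.div_atTop tendsto_natCast_atTop_atTop)
    rw [norm_div, Real.norm_eq_abs, Real.norm_natCast]
    gcongr
    exact h n
  have := hv.add h0
  rw [add_zero] at this
  refine this.congr fun n => ?_
  ring

end MatrixPressure

theorem theorem1p3 {m d : ℕ} (hm : 2 ≤ m) (hd : 1 ≤ d)
    (A : Matrix (Fin m) (Fin m) ℤ) (hA01 : ∀ i j, A i j = 0 ∨ A i j = 1) (hA : A.IsPrimitive)
    (M : MatrixPressure.Subshift A → Matrix (Fin d) (Fin d) ℝ)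
    (hMpos : ∀ x i j, 0 < M x i j) (hM : MatrixPressure.IsHolder M) :
    (∀ q : ℝ, Filter.Tendsto
      (fun n : ℕ => Real.log (MatrixPressure.partitionSum M q n) / n)
      Filter.atTop (nhds (MatrixPressure.pressure M q))) ∧
    ∀ q : ℝ, q ≠ 0 → ∃ α : ℝ, HasDerivAt (MatrixPressure.pressure M) α q ∧
      0 ≤ (-α * q + MatrixPressure.pressure M q) / Real.log m ∧
      dimH (MatrixPressure.levelSet M α) =
        ENNReal.ofReal ((-α * q + MatrixPressure.pressure M q) / Real.log m) := by
  have := MatrixPressure.Subshift.nonempty hm hA01 hA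
  obtain ⟨p, hp⟩ : ∃ p, MatrixPressure.HasGluing A p := MatrixPressure.exists_glue hA01 hA
  obtain ⟨C, hψ⟩ := MatrixPressure.exists_almostAdditive_logNorm hm hd hMpos hM
  obtain ⟨D, hD⟩ := MatrixPressure.exists_distortion hm hd hMpos hM
  obtain ⟨P, hP⟩ := hψ.exists_isPressure hp
  have ht : ∀ q : ℝ, Tendsto (fun n : ℕ => Real.log (MatrixPressure.partitionSum M q n) / n)
      atTop (𝓝 (P q)) := fun q => MatrixPressure.tendsto_div_of_abs_sub_le
    (MatrixPressure.abs_log_partitionSum_sub_le hd hMpos hD q) (hP.tendsto q)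
  obtain rfl : MatrixPressure.pressure M = P := funext fun q => (ht q).limUnder_eq
  refine ⟨ht, fun q _ => ?_⟩
  obtain ⟨α, h1, h2, h3⟩ := hψ.exists_hasDerivAt_and_dimH_eq hm hp hP q
  refine ⟨α, h1, h2, ?_⟩
  rw [← h3]
  congr 1
  ext x
  -- By bounded distortion, passing to representatives does not change limits after division by `n`,
  -- so the two level sets coincide.
  have hb : ∀ n, |MatrixPressure.logNorm M n x -
      Real.log (MatrixPressure.entrySum (MatrixPressure.cocycle M n x))| ≤ D := fun n =>
    hD n _ _ (MatrixPressure.agree_rep n x)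
  exact ⟨fun h => MatrixPressure.tendsto_div_of_abs_sub_le hb h,
    fun h => MatrixPressure.tendsto_div_of_abs_sub_le
      (fun n => by rw [abs_sub_comm]; exact hb n) h⟩
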